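/- Let $\theta>0$. Let $\mathcal H=L^2(\mathbb C,\tfrac{d^2z}{\pi})$, and let $\mathcal H_\theta\subset\mathcal H$ be the closed subspace spanned by the orthonormal functions $$h_n(z)=\frac{z^n}{\sqrt{\theta^{n+1}n!}}\,e^{-|z|^2/(2\theta)},\qquad n=0,1,2,\dots,$$ with orthogonal projection $P_\theta:\mathcal H\to\mathcal H_\theta$. For a bounded continuous function $f$ let $\pi_\theta(f)=P_\theta fP_\theta$ be the Toeplitz operator on $\mathcal H_\theta$, and let $\mathcal O_\theta$ be the real vector space of bounded operators on $\mathcal H_\theta$ spanned by the identity $\pi_\theta(1)$ and the operators $\pi_\theta(f)$ with $f$ a real-valued Schwartz function on $\mathbb C\simeq\mathbb R^2$. Let $$D=2\begin{pmatrix}0&-\bar\partial\\ \partial&0\end{pmatrix}$$ be the Dirac operator on $\mathcal H\otimes\mathbb C^2$, where $\partial=\tfrac12(\partial_x-i\partial_y)$ and $\bar\partial=\tfrac12(\partial_x+i\partial_y)$ are weak derivatives and the domain consists of the $u\in\mathcal H\otimes\mathbb C^2$ with $Du\in\mathcal H\otimes\mathbb C^2$. Let $D_\theta=2(P_\theta\otimes\mathbb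 I_2)D(P_\theta\otimes\mathbb I_2)$ be the truncated Dirac operator on $\mathcal H_\theta\otimes\mathbb C^2$, with domain $(\mathcal H_\theta\otimes\mathbb C^2)\cap\mathrm{dom}\,D$. For states $\varphi,\psi$ of $\mathcal O_\theta$ (real linear functionals of norm one with value one at the identity) put $$d_{\mathcal O_\theta,D_\theta}(\varphi,\psi)=\sup\{\varphi(T)-\psi(T)\;:\;T\in\mathcal O_\theta,\ \|[D_\theta,T\otimes\mathbb I_2]\|\le1\}\in[0,\infty],$$ where $\|[D_\theta,T\otimes\mathbb I_2]\|\le1$ means that $T\otimes\mathbb I_2$ preserves $\mathrm{dom}\,D_\theta$ and the commutator, defined on $\mathrm{dom}\,D_\theta$, is bounded with norm at most $1$. For $z\in\mathbb C$ let $\Psi_z(T)=\langle\psi_z,T\psi_z\rangle$ be the coherent state of $\mathcal O_\theta$ given by the unit vector $$\psi_z=e^{-|z|^2/(2\theta)}\sum_{n\ge0}\frac{\bar z^{\,n}}{\sqrt{\theta^n n!}}\,h_n\in\mathcal H_\theta .$$ Then, for all $z,z'\in\mathbb C$, $$d_{\mathcal O_\theta,D_\theta}(\Psi_z,\Psi_{z'})=|z-z'|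 .$$ -/

import Mathlib

open MeasureTheory Filter Topology
open scoped ENNReal NNReal ContDiff SchwartzMap BoundedContinuousFunction InnerProductSpace

namespace MoyalPlane

noncomputable section

/-! ### The Hilbert space of square integrable functions on the plane -/

/-- The measure `d²z / π` on the complex plane, `d²z` being Lebesgue measure. -/
def planeMeasure : Measure ℂ := ENNReal.ofReal Real.pi⁻¹ • (volume : Measure ℂ)

instance : IsFiniteMeasureOnCompacts planeMeasure :=
  ⟨fun K hK => by
    simpa [planeMeasure] using ENNReal.mul_lt_top ENNReal.ofReal_lt_top hK.measure_lt_top⟩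

/-- `L²(ℂ, d²z / π)`; the inner product is conjugate linear in its first argument. -/
abbrev L2Plane : Type := Lp ℂ 2 planeMeasure

/-- The Hilbert space `E ⊗ ℂ²`, written as the Hilbert sum of two copies of `E`. -/
abbrev Double (E : Type) [NormedAddCommGroup E] : Type := WithLp 2 (E × E)

section General

variable {E F : Type} [NormedAddCommGroup E] [InnerProductSpace ℂ E]
  [NormedAddCommGroup F] [InnerProductSpace ℂ F]

/-- The operator `A ⊗ 1` from `E ⊗ ℂ²` to `F ⊗ ℂ²`. -/
def ampl (A : E →L[ℂ] F) : Double E →L[ℂ] Double F :=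
  ((WithLp.prodContinuousLinearEquiv 2 ℂ F F).symm : F × F →L[ℂ] Double F) ∘L
    (A.prodMap A) ∘L
    ((WithLp.prodContinuousLinearEquiv 2 ℂ E E) : Double E →L[ℂ] E × E)

/-- The norm `‖[D, T]‖` of the commutator of a possibly unbounded operator `D` with a bounded
operator `T`: the least constant `C` such that `T` maps the domain of `D` into itself and
`‖D T v - T D v‖ ≤ C ‖v‖` on that domain, and `∞` if there is no such constant. -/
def commutatorNorm (D : E →ₗ.[ℂ] E) (T : E →L[ℂ] E) : ℝ≥0∞ :=
  ⨅ (C : ℝ≥0) (_ : ∀ v : D.domain, ∃ h : T (v : E) ∈ D.domain,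
    ‖D ⟨T (v : E), h⟩ - T (D v)‖ ≤ C * ‖(v : E)‖), (C : ℝ≥0∞)

/-- Real vector spaces of bounded operators on `E`, with the operator norm. -/
abbrev RealOpSpace (E : Type) [NormedAddCommGroup E] [InnerProductSpace ℂ E] : Type :=
  Submodule ℝ (E →L[ℂ] E)

/-- The real vector space spanned by a set of bounded operators and the identity. -/
def unitalRealSpan (S : Set (E →L[ℂ] E)) : RealOpSpace E := Submodule.span ℝ (insert 1 S)

/-- States of a real vector space `O` of operators that contains the identity: real linear functionals
of norm at most one that take the value one at the identity (so that the norm is one). -/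
structure State (O : RealOpSpace E) where
  toFunctional : O →ₗ[ℝ] ℝ
  bound : ∀ T : O, |toFunctional T| ≤ ‖(T : E →L[ℂ] E)‖
  map_one : ∀ T : O, (T : E →L[ℂ] E) = 1 → toFunctional T = 1

/-- The spectral distance `d_{O, D}` between two states of `O`, for an operator `D` on `E ⊗ ℂ²`: the
supremum of `φ(T) - ψ(T)` over those `T` in `O` with `‖[D, T ⊗ 1]‖ ≤ 1`, as an extended real
number. -/
def spectralDist {O : RealOpSpace E} (D : Double E →ₗ.[ℂ] Double E) (φ ψ : State O) : EReal :=
  ⨆ (T : O) (_ : commutatorNorm D (ampl (T : E →L[ℂ] E)) ≤ 1),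
    ((φ.toFunctional T - ψ.toFunctional T : ℝ) : EReal)

/-- The vector state `T ↦ ⟨ψ, T ψ⟩` of a unit vector `ψ`, restricted to `O`. For self-adjoint `T` the
number `⟨ψ, T ψ⟩` is real. -/
def vectorState (O : RealOpSpace E) (ψ : E) (hψ : ‖ψ‖ = 1) : State O where
  toFunctional :=
    { toFun := fun T => (⟪ψ, (T : E →L[ℂ] E) ψ⟫_ℂ).re
      map_add' := fun S T => by
        have : ((S + T : O) : E →L[ℂ] E) ψ = (S : E →L[ℂ] E) ψ + (T : E →L[ℂ] E) ψ := rfl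
        rw [this, inner_add_right, Complex.add_re]
      map_smul' := fun c T => by
        have : ((c • T : O) : E →L[ℂ] E) ψ = (c : ℂ) • (T : E →L[ℂ] E) ψ := rfl
        rw [this, inner_smul_right]
        simp }
  bound := fun T => by
    calc |(⟪ψ, (T : E →L[ℂ] E) ψ⟫_ℂ).re| ≤ ‖⟪ψ, (T : E →L[ℂ] E) ψ⟫_ℂ‖ :=
          Complex.abs_re_le_norm _
      _ ≤ ‖ψ‖ * ‖(T : E →L[ℂ] E) ψ‖ := norm_inner_le_norm _ _
      _ ≤ ‖ψ‖ * (‖(T : E →L[ℂ] E)‖ * ‖ψ‖) := by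
          gcongr
          exact (T : E →L[ℂ] E).le_opNorm ψ
      _ = ‖(T : E →L[ℂ] E)‖ := by rw [hψ]; ring
  map_one := fun T hT => by
    change (⟪ψ, (T : E →L[ℂ] E) ψ⟫_ℂ).re = 1
    rw [hT, one_apply_eq_self, inner_self_eq_norm_sq_to_K, hψ]
    simp

end General

/-! ### Toeplitz quantization -/

/-- The function `h_n(z) = z ^ n / √(θ ^ (n + 1) n!) * exp (-|z|² / (2 θ))`. -/
def fockFun (θ : ℝ) (n : ℕ) (z : ℂ) : ℂ :=
  z ^ n / (Real.sqrt (θ ^ (n + 1) * (n.factorial : ℝ)) : ℝ) *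
    (Real.exp (-‖z‖ ^ 2 / (2 * θ)) : ℝ)

theorem continuous_fockFun (θ : ℝ) (n : ℕ) : Continuous (fockFun θ n) := by
  unfold fockFun
  fun_prop

theorem integral_gaussian_moment {θ : ℝ} (hθ : 0 < θ) (n : ℕ) :
    ∫ z : ℂ, ‖z‖ ^ (2 * n) * Real.exp (-‖z‖ ^ 2 / θ) =
      Real.pi * (θ ^ (n + 1) * (n.factorial : ℝ)) := by
  have h := Complex.integral_rpow_mul_exp_neg_mul_rpow (p := 2) (q := 2 * n) (b := θ⁻¹)
    (by norm_num) (by have : (0 : ℝ) ≤ n := n.cast_nonneg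
                      linarith) (by positivity)
  have e1 : (2 * (n : ℝ) + 2) / 2 = (n : ℝ) + 1 := by ring
  have e2 : -(2 * (n : ℝ) + 2) / 2 = -((n : ℝ) + 1) := by ring
  rw [e1, e2, Real.Gamma_nat_eq_factorial, Real.rpow_neg (by positivity),
    Real.inv_rpow hθ.le, inv_inv] at h
  have e3 : θ ^ ((n : ℝ) + 1) = θ ^ (n + 1) := by
    rw [← Real.rpow_natCast]; push_cast; rfl
  rw [e3] at h
  have e4 : ∀ z : ℂ, ‖z‖ ^ (2 * n) * Real.exp (-‖z‖ ^ 2 / θ) =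
      ‖z‖ ^ (2 * (n : ℝ)) * Real.exp (-θ⁻¹ * ‖z‖ ^ (2 : ℝ)) := by
    intro z
    rw [← Real.rpow_natCast ‖z‖ (2 * n), ← Real.rpow_natCast ‖z‖ 2]
    push_cast
    congr 2
    ring
  simp_rw [e4]
  rw [h]
  ring

theorem norm_fockFun_sq {θ : ℝ} (hθ : 0 < θ) (n : ℕ) (z : ℂ) :
    ‖fockFun θ n z‖ ^ 2 =
      (θ ^ (n + 1) * (n.factorial : ℝ))⁻¹ * (‖z‖ ^ (2 * n) * Real.exp (-‖z‖ ^ 2 / θ)) := by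
  have hpos : 0 < θ ^ (n + 1) * (n.factorial : ℝ) := by positivity
  unfold fockFun
  rw [norm_mul, norm_div, norm_pow, Complex.norm_real, Complex.norm_real, Real.norm_eq_abs,
    Real.norm_eq_abs, abs_of_nonneg (Real.sqrt_nonneg _), abs_of_pos (Real.exp_pos _), mul_pow,
    div_pow, Real.sq_sqrt hpos.le, ← Real.exp_nat_mul, ← pow_mul]
  have : ((2 : ℕ) : ℝ) * (-‖z‖ ^ 2 / (2 * θ)) = -‖z‖ ^ 2 / θ := by
    push_cast; field_simp
  rw [this, mul_comm n 2]
  ring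

theorem memLp_fockFun {θ : ℝ} (hθ : 0 < θ) (n : ℕ) : MemLp (fockFun θ n) 2 planeMeasure := by
  rw [memLp_two_iff_integrable_sq_norm (continuous_fockFun θ n).aestronglyMeasurable]
  simp_rw [norm_fockFun_sq hθ]
  refine Integrable.const_mul (Integrable.smul_measure ?_ ENNReal.ofReal_ne_top) _
  apply Integrable.of_integral_ne_zero
  rw [integral_gaussian_moment hθ]
  have := Real.pi_pos
  positivity

/-- `h_n` as a vector of `L²(ℂ, d²z / π)`. -/
def fockVec (θ : ℝ) (hθ : 0 < θ) (n : ℕ) : L2Plane := (memLp_fockFun hθ n).toLp (fockFun θ n)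

/-- The closed subspace `H_θ` of `L²(ℂ, d²z / π)` spanned by the `h_n`. -/
def fockSpace (θ : ℝ) (hθ : 0 < θ) : Submodule ℂ L2Plane :=
  (Submodule.span ℂ (Set.range (fockVec θ hθ))).topologicalClosure

instance (θ : ℝ) (hθ : 0 < θ) : CompleteSpace (fockSpace θ hθ) :=
  (Submodule.isClosed_topologicalClosure _).completeSpace_coe

/-- The orthogonal projection `P_θ` of `L²(ℂ, d²z / π)` onto `H_θ`. -/
def fockProj (θ : ℝ) (hθ : 0 < θ) : L2Plane →L[ℂ] fockSpace θ hθ :=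
  (fockSpace θ hθ).orthogonalProjectionOnto

theorem memLp_top_bcf (f : ℂ →ᵇ ℂ) : MemLp f ∞ planeMeasure :=
  memLp_top_of_bound f.continuous.aestronglyMeasurable ‖f‖
    (ae_of_all _ fun z => f.norm_coe_le_norm z)

/-- Multiplication by a bounded continuous function on `L²(ℂ, d²z / π)`. -/
def mulOp (f : ℂ →ᵇ ℂ) : L2Plane →L[ℂ] L2Plane :=
  (ContinuousLinearMap.mul ℂ ℂ).holderL planeMeasure ∞ 2 2 ((memLp_top_bcf f).toLp f)

/-- Toeplitz quantization: the operator `π_θ(f) = P_θ f P_θ` on `H_θ`. -/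
def toeplitz (θ : ℝ) (hθ : 0 < θ) (f : ℂ →ᵇ ℂ) : fockSpace θ hθ →L[ℂ] fockSpace θ hθ :=
  fockProj θ hθ ∘L mulOp f ∘L (fockSpace θ hθ).subtypeL

/-- The order unit space `O_θ`: the real span of the operators `π_θ(f)`, `f` a real valued Schwartz
function, together with the order unit `π_θ(1)`, the identity of `H_θ`. -/
def orderUnitSpace (θ : ℝ) (hθ : 0 < θ) : RealOpSpace (fockSpace θ hθ) :=
  unitalRealSpan {T | ∃ f : 𝓢(ℂ, ℂ), (∀ z, (starRingEnd ℂ) (f z) = f z) ∧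
    T = toeplitz θ hθ f.toBoundedContinuousFunction}

/-! ### The Dirac operator and its truncation -/

/-- The Wirtinger derivative `∂ = (∂_x - i ∂_y) / 2`. -/
def dz (φ : ℂ → ℂ) (z : ℂ) : ℂ := (fderiv ℝ φ z 1 - Complex.I * fderiv ℝ φ z Complex.I) / 2

/-- The Wirtinger derivative `∂̄ = (∂_x + i ∂_y) / 2`. -/
def dzbar (φ : ℂ → ℂ) (z : ℂ) : ℂ := (fderiv ℝ φ z 1 + Complex.I * fderiv ℝ φ z Complex.I) / 2

/-- `v = ∂ u` in the sense of distributions. -/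
def IsWeakDz (u v : L2Plane) : Prop :=
  ∀ φ : ℂ → ℂ, ContDiff ℝ ∞ φ → HasCompactSupport φ →
    ∫ z, u z * dz φ z ∂planeMeasure = -∫ z, v z * φ z ∂planeMeasure

/-- `v = ∂̄ u` in the sense of distributions. -/
def IsWeakDzbar (u v : L2Plane) : Prop :=
  ∀ φ : ℂ → ℂ, ContDiff ℝ ∞ φ → HasCompactSupport φ →
    ∫ z, u z * dzbar φ z ∂planeMeasure = -∫ z, v z * φ z ∂planeMeasure

theorem memLp_test {φ : ℂ → ℂ} (h : Continuous φ) (h' : HasCompactSupport φ) :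
    MemLp φ 2 planeMeasure := h.memLp_of_hasCompactSupport h'

theorem integrable_mul_test (u : L2Plane) {φ : ℂ → ℂ} (h : Continuous φ)
    (h' : HasCompactSupport φ) : Integrable (fun z => u z * φ z) planeMeasure :=
  (Lp.memLp u).integrable_mul (memLp_test h h')

theorem integral_add_mul (u v : L2Plane) {φ : ℂ → ℂ} (h : Continuous φ)
    (h' : HasCompactSupport φ) :
    ∫ z, (u + v : L2Plane) z * φ z ∂planeMeasure =
      ∫ z, u z * φ z ∂planeMeasure + ∫ z, v z * φ z ∂planeMeasure := by
  rw [← integral_add (integrable_mul_test u h h') (integrable_mul_test v h h')]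
  refine integral_congr_ae ?_
  filter_upwards [Lp.coeFn_add u v] with z hz
  rw [hz, Pi.add_apply, add_mul]

theorem integral_smul_mul (c : ℂ) (u : L2Plane) (φ : ℂ → ℂ) :
    ∫ z, (c • u : L2Plane) z * φ z ∂planeMeasure = c * ∫ z, u z * φ z ∂planeMeasure := by
  rw [← integral_const_mul]
  refine integral_congr_ae ?_
  filter_upwards [Lp.coeFn_smul c u] with z hz
  rw [hz, Pi.smul_apply, smul_eq_mul, mul_assoc]

theorem integral_zero_mul (φ : ℂ → ℂ) :
    ∫ z, (0 : L2Plane) z * φ z ∂planeMeasure = 0 := by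
  simpa using integral_smul_mul 0 0 φ

theorem continuous_dz {φ : ℂ → ℂ} (h : ContDiff ℝ ∞ φ) : Continuous (dz φ) := by
  have := h.continuous_fderiv (by simp)
  unfold dz
  fun_prop

theorem continuous_dzbar {φ : ℂ → ℂ} (h : ContDiff ℝ ∞ φ) : Continuous (dzbar φ) := by
  have := h.continuous_fderiv (by simp)
  unfold dzbar
  fun_prop

theorem hasCompactSupport_dz {φ : ℂ → ℂ} (h : HasCompactSupport φ) : HasCompactSupport (dz φ) :=
  (h.fderiv (𝕜 := ℝ)).comp_left (g := fun L : ℂ →L[ℝ] ℂ => (L 1 - Complex.I * L Complex.I) / 2)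
    (by simp)

theorem hasCompactSupport_dzbar {φ : ℂ → ℂ} (h : HasCompactSupport φ) :
    HasCompactSupport (dzbar φ) :=
  (h.fderiv (𝕜 := ℝ)).comp_left (g := fun L : ℂ →L[ℝ] ℂ => (L 1 + Complex.I * L Complex.I) / 2)
    (by simp)

/-- The graph of the Dirac operator `D = 2 [[0, -∂̄], [∂, 0]]` on `L² ⊗ ℂ²`, with weak derivatives:
the pairs `((u₁, u₂), (v₁, v₂))` with `v₁ = -2 ∂̄ u₂` and `v₂ = 2 ∂ u₁`. -/
def diracGraph : Submodule ℂ (Double L2Plane × Double L2Plane) where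
  carrier := {p | IsWeakDzbar ((-2 : ℂ) • p.1.snd) p.2.fst ∧ IsWeakDz ((2 : ℂ) • p.1.fst) p.2.snd}
  zero_mem' := by
    constructor <;> intro φ _ _ <;> simp only [Prod.fst_zero, Prod.snd_zero, WithLp.zero_fst, WithLp.zero_snd,
      smul_zero, integral_zero_mul, neg_zero]
  add_mem' := by
    rintro p q ⟨hp, hp'⟩ ⟨hq, hq'⟩
    constructor <;> intro φ h h'
    · have c := continuous_dzbar h
      have s := hasCompactSupport_dzbar h'
      simp only [Prod.fst_add, Prod.snd_add, WithLp.add_fst, WithLp.add_snd, smul_add]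
      rw [integral_add_mul _ _ c s, integral_add_mul _ _ h.continuous h', hp φ h h', hq φ h h']
      ring
    · have c := continuous_dz h
      have s := hasCompactSupport_dz h'
      simp only [Prod.fst_add, Prod.snd_add, WithLp.add_fst, WithLp.add_snd, smul_add]
      rw [integral_add_mul _ _ c s, integral_add_mul _ _ h.continuous h', hp' φ h h', hq' φ h h']
      ring
  smul_mem' := by
    rintro a p ⟨hp, hp'⟩
    constructor <;> intro φ h h'
    · simp only [Prod.smul_fst, Prod.smul_snd, WithLp.smul_fst, WithLp.smul_snd]
      rw [smul_comm, integral_smul_mul a, integral_smul_mul a, hp φ h h']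
      ring
    · simp only [Prod.smul_fst, Prod.smul_snd, WithLp.smul_fst, WithLp.smul_snd]
      rw [smul_comm, integral_smul_mul a, integral_smul_mul a, hp' φ h h']
      ring

theorem eq_zero_of_test (v : L2Plane)
    (hv : ∀ φ : ℂ → ℂ, ContDiff ℝ ∞ φ → HasCompactSupport φ →
      ∫ z, v z * φ z ∂planeMeasure = 0) : v = 0 := by
  have key : ∀ᵐ z ∂planeMeasure, v z = 0 := by
    refine ae_eq_zero_of_integral_contDiff_smul_eq_zero
      ((Lp.memLp v).locallyIntegrable (by norm_num)) fun g hg hg' => ?_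
    have := hv (fun z => (g z : ℂ)) (Complex.ofRealCLM.contDiff.comp hg)
      (hg'.comp_left (g := ((↑) : ℝ → ℂ)) (by simp))
    rw [← this]
    refine integral_congr_ae (ae_of_all _ fun z => ?_)
    simp [mul_comm]
  exact (Lp.eq_zero_iff_ae_eq_zero).2 key

/-- Weak derivatives are unique, so `diracGraph` is the graph of an operator. -/
theorem diracGraph_functional :
    ∀ p ∈ diracGraph, p.1 = 0 → p.2 = 0 := by
  rintro ⟨u, v⟩ ⟨h1, h2⟩ hu
  have hu' : u = 0 := hu
  subst hu'
  have e1 : v.fst = 0 := eq_zero_of_test _ fun φ h h' => by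
    have := h1 φ h h'
    simp only [WithLp.zero_snd, smul_zero, integral_zero_mul] at this
    exact neg_eq_zero.1 this.symm
  have e2 : v.snd = 0 := eq_zero_of_test _ fun φ h h' => by
    have := h2 φ h h'
    simp only [WithLp.zero_fst, smul_zero, integral_zero_mul] at this
    exact neg_eq_zero.1 this.symm
  exact (WithLp.ofLp_injective 2) (Prod.ext e1 e2)

/-- The Dirac operator `D = 2 [[0, -∂̄], [∂, 0]]` of the plane, as an unbounded operator on
`L² ⊗ ℂ²`, on the domain of those spinors whose image is again square integrable. -/
def dirac : Double L2Plane →ₗ.[ℂ] Double L2Plane := diracGraph.toLinearPMap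

/-- The truncated Dirac operator `D_θ = 2 (P_θ ⊗ 1) D (P_θ ⊗ 1)`, as an unbounded operator on
`H_θ ⊗ ℂ²` with domain the spinors in `H_θ ⊗ ℂ²` that belong to the domain of `D`. -/
def truncDirac (θ : ℝ) (hθ : 0 < θ) :
    Double (fockSpace θ hθ) →ₗ.[ℂ] Double (fockSpace θ hθ) where
  domain := dirac.domain.comap (ampl (fockSpace θ hθ).subtypeL).toLinearMap
  toFun := (2 : ℂ) • ((ampl (fockProj θ hθ)).toLinearMap ∘ₗ dirac.toFun ∘ₗ
    ((ampl (fockSpace θ hθ).subtypeL).toLinearMap.restrict fun _ hv => hv))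

/-! ### Coherent states -/

theorem fockVec_mem (θ : ℝ) (hθ : 0 < θ) (n : ℕ) : fockVec θ hθ n ∈ fockSpace θ hθ :=
  Submodule.le_topologicalClosure _ (Submodule.subset_span ⟨n, rfl⟩)

/-- `h_n` as a vector of `H_θ`. -/
def fockBasis (θ : ℝ) (hθ : 0 < θ) (n : ℕ) : fockSpace θ hθ := ⟨fockVec θ hθ n, fockVec_mem θ hθ n⟩

/-- The coefficient `z̄ ^ n / √(θ ^ n n!)`. -/
def cohCoeff (θ : ℝ) (z : ℂ) (n : ℕ) : ℂ :=
  (starRingEnd ℂ) z ^ n / (Real.sqrt (θ ^ n * (n.factorial : ℝ)) : ℝ)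

/-- The vector `ψ_z = exp (-|z|² / (2 θ)) ∑ n, z̄ ^ n / √(θ ^ n n!) h_n` of `H_θ`. -/
def cohVec (θ : ℝ) (hθ : 0 < θ) (z : ℂ) : fockSpace θ hθ :=
  ((Real.exp (-‖z‖ ^ 2 / (2 * θ)) : ℝ) : ℂ) • ∑' n : ℕ, cohCoeff θ z n • fockBasis θ hθ n

theorem integral_fockFun_of_ne (θ : ℝ) {m n : ℕ} (hmn : m ≠ n) :
    ∫ z, fockFun θ n z * (starRingEnd ℂ) (fockFun θ m z) = 0 := by
  set F : ℂ → ℂ := fun z => fockFun θ n z * (starRingEnd ℂ) (fockFun θ m z) with hF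
  have hd : ((n : ℂ) - m) ≠ 0 := sub_ne_zero.2 (by exact_mod_cast hmn.symm)
  set α : ℝ := Real.pi / ((n : ℝ) - m) with hα
  set c : Circle := Circle.exp α with hc
  have hcn : ‖(c : ℂ)‖ = 1 := Circle.norm_coe c
  have hcc : (c : ℂ) * (starRingEnd ℂ) (c : ℂ) = 1 := by
    rw [Complex.mul_conj, Complex.normSq_eq_norm_sq, hcn]; simp
  have hrot : (c : ℂ) ^ n * (starRingEnd ℂ) (c : ℂ) ^ m = -1 := by
    rw [hc, Circle.coe_exp, ← Complex.exp_conj, ← Complex.exp_nat_mul, ← Complex.exp_nat_mul,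
      ← Complex.exp_add, ← Complex.exp_pi_mul_I]
    congr 1
    simp only [map_mul, Complex.conj_ofReal, Complex.conj_I, hα]
    push_cast
    field_simp
    ring
  have hFc : ∀ z, F (rotation c z) = -F z := by
    intro z
    have hn : ‖(c : ℂ) * z‖ = ‖z‖ := by rw [norm_mul, hcn, one_mul]
    simp only [hF, rotation_apply, fockFun, hn, map_mul, map_div₀, map_pow, Complex.conj_ofReal,
      mul_pow]
    linear_combination ((z ^ n / (Real.sqrt (θ ^ (n + 1) * (n.factorial : ℝ)) : ℝ) *
      (Real.exp (-‖z‖ ^ 2 / (2 * θ)) : ℝ)) * ((starRingEnd ℂ) z ^ m /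
      (Real.sqrt (θ ^ (m + 1) * (m.factorial : ℝ)) : ℝ) *
      (Real.exp (-‖z‖ ^ 2 / (2 * θ)) : ℝ))) * hrot
  have h1 : ∫ z, F (rotation c z) = ∫ z, F z :=
    (rotation c).measurePreserving.integral_comp
      (rotation c).toHomeomorph.measurableEmbedding F
  have h2 : ∫ z, F (rotation c z) = -∫ z, F z := by
    simp_rw [hFc]; exact integral_neg F
  have h3 : (2 : ℂ) * ∫ z, F z = 0 := by linear_combination h2 - h1
  simpa using h3

theorem orthonormal_fockVec (θ : ℝ) (hθ : 0 < θ) : Orthonormal ℂ (fockVec θ hθ) := by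
  have key : ∀ m n, ⟪fockVec θ hθ m, fockVec θ hθ n⟫_ℂ =
      ((Real.pi⁻¹ : ℝ) : ℂ) * ∫ z, fockFun θ n z * (starRingEnd ℂ) (fockFun θ m z) := by
    intro m n
    have h0 : ∫ z, ⟪fockVec θ hθ m z, fockVec θ hθ n z⟫_ℂ ∂planeMeasure =
        ∫ z, fockFun θ n z * (starRingEnd ℂ) (fockFun θ m z) ∂planeMeasure := by
      refine integral_congr_ae ?_
      filter_upwards [(memLp_fockFun hθ m).coeFn_toLp, (memLp_fockFun hθ n).coeFn_toLp]
        with z hm hn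
      simp only [fockVec, hm, hn, RCLike.inner_apply]
    rw [L2.inner_def, h0, planeMeasure, integral_smul_measure,
      ENNReal.toReal_ofReal (inv_nonneg.2 Real.pi_pos.le)]
    rfl
  rw [orthonormal_iff_ite]
  intro m n
  rw [key]
  split_ifs with h
  · subst h
    have e : ∀ z, fockFun θ m z * (starRingEnd ℂ) (fockFun θ m z) =
        (((θ ^ (m + 1) * (m.factorial : ℝ))⁻¹ *
          (‖z‖ ^ (2 * m) * Real.exp (-‖z‖ ^ 2 / θ)) : ℝ) : ℂ) := by
      intro z
      rw [Complex.mul_conj, Complex.normSq_eq_norm_sq, norm_fockFun_sq hθ]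
    simp_rw [e]
    rw [integral_complex_ofReal, integral_const_mul, integral_gaussian_moment hθ,
      ← Complex.ofReal_mul]
    have h1 : 0 < θ ^ (m + 1) * (m.factorial : ℝ) := by positivity
    have h2 := Real.pi_pos
    norm_cast
    field_simp
  · rw [integral_fockFun_of_ne θ h, mul_zero]

theorem orthonormal_fockBasis (θ : ℝ) (hθ : 0 < θ) : Orthonormal ℂ (fockBasis θ hθ) := by
  have h := orthonormal_fockVec θ hθ
  rw [orthonormal_iff_ite] at h ⊢
  intro m n
  exact h m n

theorem hasSum_cohCoeff_sq {θ : ℝ} (hθ : 0 < θ) (z : ℂ) :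
    HasSum (fun n => ‖cohCoeff θ z n‖ ^ 2) (Real.exp (‖z‖ ^ 2 / θ)) := by
  have h := NormedSpace.expSeries_div_hasSum_exp (𝔸 := ℝ) (‖z‖ ^ 2 / θ)
  rw [← Real.exp_eq_exp_ℝ] at h
  have e : (fun n => ‖cohCoeff θ z n‖ ^ 2) = fun n : ℕ => (‖z‖ ^ 2 / θ) ^ n / (n.factorial : ℝ) := by
    funext n
    have hpos : 0 < θ ^ n * (n.factorial : ℝ) := by positivity
    rw [cohCoeff, norm_div, norm_pow, RCLike.norm_conj, Complex.norm_real, Real.norm_eq_abs,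
      abs_of_nonneg (Real.sqrt_nonneg _), div_pow, Real.sq_sqrt hpos.le, div_pow, div_div,
      pow_right_comm]
  rw [e]
  exact h

theorem summable_cohVec {θ : ℝ} (hθ : 0 < θ) (z : ℂ) :
    Summable fun n => cohCoeff θ z n • fockBasis θ hθ n := by
  have h := ((orthonormal_fockBasis θ hθ).orthogonalFamily.summable_iff_norm_sq_summable
    (cohCoeff θ z)).2 (hasSum_cohCoeff_sq hθ z).summable
  simpa [LinearIsometry.toSpanSingleton_apply] using h

theorem norm_tsum_of_orthonormal {E : Type} [NormedAddCommGroup E] [InnerProductSpace ℂ E]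
    {b : ℕ → E} (hb : Orthonormal ℂ b) {c : ℕ → ℂ} (hc : Summable fun n => c n • b n) {r : ℝ}
    (hr : HasSum (fun n => ‖c n‖ ^ 2) r) : ‖∑' n, c n • b n‖ ^ 2 = r := by
  have ho := orthonormal_iff_ite.1 hb
  have hs := hc.hasSum
  generalize ∑' n, c n • b n = w at hs ⊢
  have hin : ∀ n, ⟪b n, w⟫_ℂ = c n := by
    intro n
    have h1 : HasSum (fun m => ⟪b n, c m • b m⟫_ℂ) ⟪b n, w⟫_ℂ := hs.mapL (innerSL ℂ (b n))
    have h2 : HasSum (fun m => ⟪b n, c m • b m⟫_ℂ) (c n) := by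
      convert hasSum_ite_eq n (c n) using 2 with m
      rw [inner_smul_right, ho]
      by_cases h : n = m
      · subst h
        simp
      · rw [if_neg h, if_neg (fun e => h e.symm), mul_zero]
    exact h1.unique h2
  have hww : HasSum (fun n => ((‖c n‖ ^ 2 : ℝ) : ℂ)) ⟪w, w⟫_ℂ := by
    have h1 : HasSum (fun m => ⟪w, c m • b m⟫_ℂ) ⟪w, w⟫_ℂ := hs.mapL (innerSL ℂ w)
    convert h1 using 2 with n
    rw [inner_smul_right, ← inner_conj_symm, hin, Complex.mul_conj, Complex.normSq_eq_norm_sq]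
  have h3 : ⟪w, w⟫_ℂ = (r : ℂ) := hww.unique (Complex.hasSum_ofReal.2 hr)
  rw [inner_self_eq_norm_sq_to_K] at h3
  exact Complex.ofReal_injective ((Complex.ofReal_pow _ _).trans h3)

theorem norm_cohVec {θ : ℝ} (hθ : 0 < θ) (z : ℂ) : ‖cohVec θ hθ z‖ = 1 := by
  have h4 := norm_tsum_of_orthonormal (orthonormal_fockBasis θ hθ) (summable_cohVec hθ z)
    (hasSum_cohCoeff_sq hθ z)
  have h5 : ‖cohVec θ hθ z‖ ^ 2 = 1 := by
    rw [cohVec, norm_smul, mul_pow, h4, Complex.norm_real, Real.norm_eq_abs,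
      abs_of_pos (Real.exp_pos _), ← Real.exp_nat_mul, ← Real.exp_add, Real.exp_eq_one_iff]
    push_cast
    field_simp
    ring
  exact (pow_eq_one_iff_of_nonneg (norm_nonneg _) two_ne_zero).1 h5

/-- The coherent state `Ψ_z = ⟨ψ_z, · ψ_z⟩` of `O_θ`. -/
def coherentState (θ : ℝ) (hθ : 0 < θ) (z : ℂ) : State (orderUnitSpace θ hθ) :=
  vectorState _ (cohVec θ hθ z) (norm_cohVec hθ z)

end

end MoyalPlane

/-!
In the basis `h_n` of `H_θ`, multiplication by `z` is a weighted shift,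
`z h_n = κ_{n+1} h_{n+1}` with `κ_n = √(θ n)`. Write `a†` for this shift (`IsRaise`) and `a` for its
adjoint (`IsLower`); both are handled as relations between coefficients, so that no domain has to be
carried along. Since `h_n` is an analytic function times `exp (-|z|² / (2 θ))`, one has
`P_θ ∂̄ = -(2 θ)⁻¹ a†` and `P_θ ∂ = (2 θ)⁻¹ a` on `H_θ`, hence `D_θ = (2 / θ) [[0, a†], [a, 0]]`
(`truncDirac_ladder`; the weak derivatives are tested against `h̄_n` by means of a cutoff,
`weak_derivative_extend`).

For Toeplitz operators, `a π(f) = π(z̄ f)` because multiplication by `z` preserves `H_θ`, and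
`a† π(f) = π(z f) - θ π(∂̄f)` by integration by parts (`isRaise_toeplitz`). Taking adjoints gives
the same for `π(f) a†` and `π(f) a`, and so the commutator of `D_θ` with `c + π(f)` is
`2 [[0, -π(∂̄f)], [π(∂f), 0]]` (`commutator_eq`): Toeplitz quantization intertwines `D_θ` with the
gradient.

The coherent state at `z` sends `π(f)` to the average of `f` against a Gaussian centred at `z`
(`inner_cohVec_toeplitz`). The derivative of this average in `z` is the coherent state applied to
`π(∂f)` and `π(∂̄f)`, so a commutator of norm at most one makes it `1`-Lipschitz
(`coherentState_sub_le`); this is the upper bound. Conversely every real test function with gradient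
bounded by one is admissible (`le_spectralDist`), as Toeplitz quantization does not increase the
supremum norm. Applied to logarithmically cut off linear functions in the direction of `z - z'`
(`cutLinear`), whose Gaussian averages at `z` and `z'` differ in the limit by `|z - z'|`, this gives
the lower bound.
-/

namespace MoyalPlane

noncomputable section

open scoped ComplexConjugate

/-! ### Wirtinger calculus -/

/-- The real linear map `h ↦ a h + b h̄` of the plane. -/
def wirtMap (a b : ℂ) : ℂ →L[ℝ] ℂ :=
  a • ContinuousLinearMap.id ℝ ℂ + b • (Complex.conjCLE : ℂ →L[ℝ] ℂ)

@[simp] theorem wirtMap_apply (a b h : ℂ) : wirtMap a b h = a * h + b * conj h := rfl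

/-- `φ` is real differentiable at `z` with `∂φ = a` and `∂̄φ = b` there. -/
def HasWirt (φ : ℂ → ℂ) (a b z : ℂ) : Prop := HasFDerivAt φ (wirtMap a b) z

theorem HasWirt.dz_eq {φ : ℂ → ℂ} {a b z : ℂ} (h : HasWirt φ a b z) : dz φ z = a := by
  rw [dz, h.fderiv]
  simp only [wirtMap_apply, map_one, Complex.conj_I]
  linear_combination (-(a - b) / 2) * Complex.I_mul_I

theorem HasWirt.dzbar_eq {φ : ℂ → ℂ} {a b z : ℂ} (h : HasWirt φ a b z) : dzbar φ z = b := by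
  rw [dzbar, h.fderiv]
  simp only [wirtMap_apply, map_one, Complex.conj_I]
  linear_combination ((a - b) / 2) * Complex.I_mul_I

theorem fderiv_eq_wirtMap (φ : ℂ → ℂ) (z : ℂ) :
    fderiv ℝ φ z = wirtMap (dz φ z) (dzbar φ z) := by
  ext h
  have e : h = h.re • (1 : ℂ) + h.im • Complex.I := by
    simp [Complex.re_add_im]
  have e' : conj h = h.re - h.im * Complex.I := by
    apply Complex.ext <;> simp
  have e'' : h = h.re + h.im * Complex.I := (Complex.re_add_im h).symm
  conv_lhs => rw [e, map_add, map_smul, map_smul]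
  rw [wirtMap_apply, e', dz, dzbar]
  conv_rhs => rw [e'']
  simp only [Complex.real_smul, Complex.add_re, Complex.add_im, Complex.ofReal_re, Complex.ofReal_im,
    Complex.mul_re, Complex.mul_im, Complex.I_re, Complex.I_im]
  push_cast
  linear_combination ((h.im : ℂ) * fderiv ℝ φ z Complex.I) * Complex.I_mul_I

theorem HasWirt.mul {φ ψ : ℂ → ℂ} {a b a' b' z : ℂ} (h : HasWirt φ a b z)
    (h' : HasWirt ψ a' b' z) :
    HasWirt (fun w => φ w * ψ w) (φ z * a' + a * ψ z) (φ z * b' + b * ψ z) z := by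
  refine (HasFDerivAt.mul h h').congr_fderiv ?_
  ext w
  simp
  ring

theorem HasWirt.conj {φ : ℂ → ℂ} {a b z : ℂ} (h : HasWirt φ a b z) :
    HasWirt (fun w => conj (φ w)) (conj b) (conj a) z := by
  refine ((Complex.conjCLE : ℂ →L[ℝ] ℂ).hasFDerivAt.comp z h).congr_fderiv ?_
  ext w
  simp
  ring

theorem HasWirt.const_mul {φ : ℂ → ℂ} {a b z : ℂ} (c : ℂ) (h : HasWirt φ a b z) :
    HasWirt (fun w => c * φ w) (c * a) (c * b) z := by
  refine (HasFDerivAt.const_mul h c).congr_fderiv ?_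
  ext w
  simp
  ring

theorem HasWirt.cexp {φ : ℂ → ℂ} {a b z : ℂ} (h : HasWirt φ a b z) :
    HasWirt (fun w => Complex.exp (φ w)) (Complex.exp (φ z) * a) (Complex.exp (φ z) * b) z := by
  refine (HasFDerivAt.cexp h).congr_fderiv ?_
  ext w
  simp
  ring

theorem hasWirt_of_hasDerivAt {φ : ℂ → ℂ} {a z : ℂ} (h : HasDerivAt φ a z) :
    HasWirt φ a 0 z := by
  refine (h.hasFDerivAt.restrictScalars ℝ).congr_fderiv ?_
  ext w
  simp [mul_comm]

instance : planeMeasure.IsAddHaarMeasure :=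
  Measure.IsAddHaarMeasure.smul _ (ENNReal.ofReal_pos.2 (inv_pos.2 Real.pi_pos)).ne'
    ENNReal.ofReal_ne_top

/-- Integration by parts for one Wirtinger derivative of each factor; `c = -I` gives `∂` and
`c = I` gives `∂̄`. -/
theorem integral_mul_wirtinger {F G : ℂ → ℂ} (c : ℂ) (hF : Differentiable ℝ F)
    (hG : Differentiable ℝ G) (hFG : Integrable (fun z => F z * G z) planeMeasure)
    (h1 : ∀ v, Integrable (fun z => fderiv ℝ F z v * G z) planeMeasure)
    (h2 : ∀ v, Integrable (fun z => F z * fderiv ℝ G z v) planeMeasure) :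
    ∫ z, F z * ((fderiv ℝ G z 1 + c * fderiv ℝ G z Complex.I) / 2) ∂planeMeasure =
      -∫ z, (fderiv ℝ F z 1 + c * fderiv ℝ F z Complex.I) / 2 * G z ∂planeMeasure := by
  have key : ∀ v, ∫ z, F z * fderiv ℝ G z v ∂planeMeasure =
      -∫ z, fderiv ℝ F z v * G z ∂planeMeasure := fun v =>
    integral_mul_fderiv_eq_neg_fderiv_mul_of_integrable (h1 v) (h2 v) hFG
      (fun x _ => hF x) (fun x _ => hG x)
  have e1 : ∀ z, F z * ((fderiv ℝ G z 1 + c * fderiv ℝ G z Complex.I) / 2) =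
      (1 / 2) * (F z * fderiv ℝ G z 1) + c / 2 * (F z * fderiv ℝ G z Complex.I) := fun z => by ring
  have e2 : ∀ z, (fderiv ℝ F z 1 + c * fderiv ℝ F z Complex.I) / 2 * G z =
      (1 / 2) * (fderiv ℝ F z 1 * G z) + c / 2 * (fderiv ℝ F z Complex.I * G z) := fun z => by ring
  simp_rw [e1, e2]
  rw [integral_add ((h2 1).const_mul _) ((h2 Complex.I).const_mul _),
    integral_add ((h1 1).const_mul _) ((h1 Complex.I).const_mul _), integral_const_mul,
    integral_const_mul, integral_const_mul, integral_const_mul, key, key]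
  ring

theorem integral_mul_dz {F G : ℂ → ℂ} (hF : Differentiable ℝ F)
    (hG : Differentiable ℝ G) (hFG : Integrable (fun z => F z * G z) planeMeasure)
    (h1 : ∀ v, Integrable (fun z => fderiv ℝ F z v * G z) planeMeasure)
    (h2 : ∀ v, Integrable (fun z => F z * fderiv ℝ G z v) planeMeasure) :
    ∫ z, F z * dz G z ∂planeMeasure = -∫ z, dz F z * G z ∂planeMeasure := by
  have := integral_mul_wirtinger (-Complex.I) hF hG hFG h1 h2
  simpa only [neg_mul, ← sub_eq_add_neg, dz] using this

theorem integral_mul_dzbar {F G : ℂ → ℂ} (hF : Differentiable ℝ F)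
    (hG : Differentiable ℝ G) (hFG : Integrable (fun z => F z * G z) planeMeasure)
    (h1 : ∀ v, Integrable (fun z => fderiv ℝ F z v * G z) planeMeasure)
    (h2 : ∀ v, Integrable (fun z => F z * fderiv ℝ G z v) planeMeasure) :
    ∫ z, F z * dzbar G z ∂planeMeasure = -∫ z, dzbar F z * G z ∂planeMeasure :=
  integral_mul_wirtinger Complex.I hF hG hFG h1 h2

/-! ### The functions `h_n` -/

/-- The matrix element `κ_n = √(θ n)` of the ladder operators: `z h_n = κ_{n+1} h_{n+1}`. -/
def ladder (θ : ℝ) (n : ℕ) : ℝ := Real.sqrt (θ * n)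

@[simp] theorem ladder_zero (θ : ℝ) : ladder θ 0 = 0 := by simp [ladder]

theorem ladder_succ_pos {θ : ℝ} (hθ : 0 < θ) (n : ℕ) : 0 < ladder θ (n + 1) :=
  Real.sqrt_pos.2 (by positivity)

theorem ladder_sq {θ : ℝ} (hθ : 0 < θ) (n : ℕ) : ladder θ n * ladder θ n = θ * n :=
  Real.mul_self_sqrt (by positivity)

theorem sqrt_norm_succ {θ : ℝ} (hθ : 0 < θ) (n : ℕ) :
    Real.sqrt (θ ^ (n + 1 + 1) * ((n + 1).factorial : ℝ)) =
      ladder θ (n + 1) * Real.sqrt (θ ^ (n + 1) * (n.factorial : ℝ)) := by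
  rw [ladder, ← Real.sqrt_mul (by positivity)]
  congr 1
  push_cast [Nat.factorial_succ]
  ring

theorem fockFun_eq (θ : ℝ) (n : ℕ) (z : ℂ) :
    fockFun θ n z = ((Real.sqrt (θ ^ (n + 1) * (n.factorial : ℝ)) : ℝ) : ℂ)⁻¹ *
      (z ^ n * Complex.exp (-(1 / (2 * θ) : ℂ) * (z * conj z))) := by
  have e : ((Real.exp (-‖z‖ ^ 2 / (2 * θ)) : ℝ) : ℂ) =
      Complex.exp (-(1 / (2 * θ) : ℂ) * (z * conj z)) := by
    rw [Complex.mul_conj, Complex.normSq_eq_norm_sq]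
    push_cast
    congr 1
    ring
  rw [fockFun, e]
  ring

theorem mul_fockFun {θ : ℝ} (hθ : 0 < θ) (n : ℕ) (z : ℂ) :
    z * fockFun θ n z = ladder θ (n + 1) * fockFun θ (n + 1) z := by
  have h1 : (ladder θ (n + 1) : ℂ) ≠ 0 := by exact_mod_cast (ladder_succ_pos hθ n).ne'
  rw [fockFun_eq, fockFun_eq, sqrt_norm_succ hθ]
  push_cast
  rw [mul_inv]
  field_simp
  ring

theorem hasWirt_fockFun {θ : ℝ} (hθ : 0 < θ) (n : ℕ) (z : ℂ) :
    HasWirt (fockFun θ n)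
      ((ladder θ n : ℂ) / θ * fockFun θ (n - 1) z - 1 / (2 * θ) * conj z * fockFun θ n z)
      (-(1 / (2 * θ) : ℂ) * (z * fockFun θ n z)) z := by
  have hid : HasWirt (fun w => w) 1 0 z := hasWirt_of_hasDerivAt (hasDerivAt_id z)
  have hpow : HasWirt (fun w => w ^ n) (n * z ^ (n - 1)) 0 z :=
    hasWirt_of_hasDerivAt (hasDerivAt_pow n z)
  have h := (hpow.mul ((hid.mul hid.conj).const_mul (-(1 / (2 * θ) : ℂ))).cexp).const_mul
    ((Real.sqrt (θ ^ (n + 1) * (n.factorial : ℝ)) : ℝ) : ℂ)⁻¹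
  have e : fockFun θ n = _ := funext (fockFun_eq θ n)
  rw [e]
  convert h using 1
  · beta_reduce
    cases n with
    | zero => simp; ring
    | succ m =>
      have h1 : (ladder θ (m + 1) : ℂ) ≠ 0 := by exact_mod_cast (ladder_succ_pos hθ m).ne'
      have h2 : (ladder θ (m + 1) : ℂ) * ladder θ (m + 1) = θ * (m + 1 : ℕ) := by
        exact_mod_cast ladder_sq hθ (m + 1)
      have h3 : (θ : ℂ) ≠ 0 := by exact_mod_cast hθ.ne'
      rw [fockFun_eq, sqrt_norm_succ hθ, Nat.add_sub_cancel]
      generalize Complex.exp _ = E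
      generalize Real.sqrt _ = s
      have h4 : (ladder θ (m + 1) : ℂ) / θ = (ladder θ (m + 1) : ℂ)⁻¹ * (m + 1 : ℕ) := by
        field_simp
        linear_combination h2
      rw [h4]
      simp only [map_zero]
      push_cast
      ring
  · simp only [map_one]
    ring

theorem contDiff_fockFun (θ : ℝ) (n : ℕ) : ContDiff ℝ ∞ (fockFun θ n) := by
  have e : fockFun θ n = _ := funext (fockFun_eq θ n)
  rw [e]
  have hc : ContDiff ℝ ∞ (fun z : ℂ => conj z) := (Complex.conjCLE : ℂ →L[ℝ] ℂ).contDiff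
  fun_prop

theorem dz_fockFun {θ : ℝ} (hθ : 0 < θ) (n : ℕ) (z : ℂ) :
    dz (fockFun θ n) z = (ladder θ n : ℂ) / θ * fockFun θ (n - 1) z -
      1 / (2 * θ) * conj z * fockFun θ n z :=
  (hasWirt_fockFun hθ n z).dz_eq

theorem dzbar_fockFun {θ : ℝ} (hθ : 0 < θ) (n : ℕ) (z : ℂ) :
    dzbar (fockFun θ n) z = -(1 / (2 * θ) : ℂ) * (ladder θ (n + 1) * fockFun θ (n + 1) z) := by
  rw [(hasWirt_fockFun hθ n z).dzbar_eq, mul_fockFun hθ]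

theorem dz_conj_fockFun {θ : ℝ} (hθ : 0 < θ) (n : ℕ) (z : ℂ) :
    dz (fun w => conj (fockFun θ n w)) z =
      -(1 / (2 * θ) : ℂ) * (ladder θ (n + 1) * conj (fockFun θ (n + 1) z)) := by
  rw [(hasWirt_fockFun hθ n z).conj.dz_eq, mul_fockFun hθ]
  simp [Complex.conj_ofNat]

theorem dzbar_conj_fockFun {θ : ℝ} (hθ : 0 < θ) (n : ℕ) (z : ℂ) :
    dzbar (fun w => conj (fockFun θ n w)) z = (ladder θ n : ℂ) / θ * conj (fockFun θ (n - 1) z) -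
      1 / (2 * θ) * (z * conj (fockFun θ n z)) := by
  rw [(hasWirt_fockFun hθ n z).conj.dzbar_eq]
  simp [Complex.conj_ofNat]
  ring

/-! ### The Fock space: orthonormal basis and ladder relations -/

theorem inner_L2Plane (u v : L2Plane) : ⟪u, v⟫_ℂ = ∫ z, conj (u z) * v z ∂planeMeasure := by
  rw [L2.inner_def]
  refine integral_congr_ae (ae_of_all _ fun z => ?_)
  simp only [RCLike.inner_apply, mul_comm]

theorem fockVec_ae {θ : ℝ} (hθ : 0 < θ) (n : ℕ) :
    (fockVec θ hθ n : ℂ → ℂ) =ᵐ[planeMeasure] fockFun θ n :=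
  (memLp_fockFun hθ n).coeFn_toLp

theorem inner_fockVec {θ : ℝ} (hθ : 0 < θ) (n : ℕ) (u : L2Plane) :
    ⟪fockVec θ hθ n, u⟫_ℂ = ∫ z, conj (fockFun θ n z) * u z ∂planeMeasure := by
  rw [inner_L2Plane]
  refine integral_congr_ae ?_
  filter_upwards [fockVec_ae hθ n] with z hz
  rw [hz]

/-- The functions `h_n` as a Hilbert basis of `H_θ`. -/
def fockHilbertBasis {θ : ℝ} (hθ : 0 < θ) : HilbertBasis ℕ ℂ (fockSpace θ hθ) :=
  HilbertBasis.mkOfOrthogonalEqBot (orthonormal_fockBasis θ hθ) <| by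
    rw [Submodule.eq_bot_iff]
    intro x hx
    have h1 : ∀ n, ⟪fockVec θ hθ n, (x : L2Plane)⟫_ℂ = 0 := fun n =>
      hx (fockBasis θ hθ n) (Submodule.subset_span ⟨n, rfl⟩)
    have h2 : Submodule.span ℂ (Set.range (fockVec θ hθ)) ≤
        (ℂ ∙ (x : L2Plane))ᗮ := by
      rw [Submodule.span_le]
      rintro _ ⟨n, rfl⟩
      exact Submodule.mem_orthogonal_singleton_iff_inner_left.2 (h1 n)
    have h3 := Submodule.topologicalClosure_minimal _ h2 (Submodule.isClosed_orthogonal _) x.2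
    have h4 := Submodule.mem_orthogonal_singleton_iff_inner_left.1 h3
    exact Subtype.ext (inner_self_eq_zero.1 h4)

@[simp] theorem fockHilbertBasis_apply {θ : ℝ} (hθ : 0 < θ) (n : ℕ) :
    fockHilbertBasis hθ n = fockBasis θ hθ n := by
  simp [fockHilbertBasis]

theorem dense_span_fockBasis {θ : ℝ} (hθ : 0 < θ) :
    Dense (Submodule.span ℂ (Set.range (fockBasis θ hθ)) : Set (fockSpace θ hθ)) := by
  have h := (fockHilbertBasis hθ).dense_span
  have e : ⇑(fockHilbertBasis hθ) = fockBasis θ hθ :=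
    funext (fockHilbertBasis_apply hθ)
  rw [e] at h
  exact Submodule.dense_iff_topologicalClosure_eq_top.2 h

theorem hasSum_fockBasis {θ : ℝ} (hθ : 0 < θ) (y : fockSpace θ hθ) :
    HasSum (fun n => ⟪fockBasis θ hθ n, y⟫_ℂ • fockBasis θ hθ n) y := by
  simpa [HilbertBasis.repr_apply_apply] using (fockHilbertBasis hθ).hasSum_repr y

theorem fockSpace_ext {θ : ℝ} {hθ : 0 < θ} {x y : fockSpace θ hθ}
    (h : ∀ n, ⟪fockBasis θ hθ n, x⟫_ℂ = ⟪fockBasis θ hθ n, y⟫_ℂ) : x = y := by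
  refine (hasSum_fockBasis hθ x).unique ?_
  simp_rw [h]
  exact hasSum_fockBasis hθ y

theorem inner_fockBasis_proj {θ : ℝ} (hθ : 0 < θ) (n : ℕ) (g : L2Plane) :
    ⟪fockBasis θ hθ n, fockProj θ hθ g⟫_ℂ = ⟪fockVec θ hθ n, g⟫_ℂ :=
  Submodule.inner_orthogonalProjectionOnto_eq_of_mem_left _ _

theorem inner_fockBasis_fockBasis {θ : ℝ} (hθ : 0 < θ) (m n : ℕ) :
    ⟪fockBasis θ hθ m, fockBasis θ hθ n⟫_ℂ = if m = n then 1 else 0 :=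
  orthonormal_iff_ite.1 (orthonormal_fockBasis θ hθ) m n

theorem inner_fockSpace_smul {θ : ℝ} {hθ : 0 < θ} (x y : fockSpace θ hθ) (c : ℂ) :
    ⟪x, c • y⟫_ℂ = c * ⟪x, y⟫_ℂ :=
  inner_smul_right x y c

theorem conj_inner_fockSpace {θ : ℝ} {hθ : 0 < θ} (x y : fockSpace θ hθ) :
    conj ⟪y, x⟫_ℂ = ⟪x, y⟫_ℂ :=
  inner_conj_symm x y

/-- `b = a y` for the annihilation operator `a h_n = κ_n h_{n-1}`, as a relation between the
coefficients of `y` and `b`. -/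
def IsLower {θ : ℝ} {hθ : 0 < θ} (y b : fockSpace θ hθ) : Prop :=
  ∀ m, ⟪fockBasis θ hθ m, b⟫_ℂ = ladder θ (m + 1) * ⟪fockBasis θ hθ (m + 1), y⟫_ℂ

/-- `b = a† y` for the creation operator `a† h_n = κ_{n+1} h_{n+1}`, as a relation between the
coefficients of `y` and `b`. For `m = 0` the right-hand side vanishes because `κ_0 = 0`. -/
def IsRaise {θ : ℝ} {hθ : 0 < θ} (y b : fockSpace θ hθ) : Prop :=
  ∀ m, ⟪fockBasis θ hθ m, b⟫_ℂ = ladder θ m * ⟪fockBasis θ hθ (m - 1), y⟫_ℂ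

section ladder

variable {θ : ℝ} {hθ : 0 < θ}

theorem IsLower.unique {y b b' : fockSpace θ hθ} (h : IsLower y b) (h' : IsLower y b') : b = b' :=
  fockSpace_ext fun m => by rw [h m, h' m]

theorem IsRaise.unique {y b b' : fockSpace θ hθ} (h : IsRaise y b) (h' : IsRaise y b') : b = b' :=
  fockSpace_ext fun m => by rw [h m, h' m]

theorem IsLower.smul {y b : fockSpace θ hθ} (h : IsLower y b) (c : ℂ) :
    IsLower (c • y) (c • b) := fun m => by
  rw [inner_fockSpace_smul, inner_fockSpace_smul, h m]
  ring

theorem IsRaise.smul {y b : fockSpace θ hθ} (h : IsRaise y b) (c : ℂ) :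
    IsRaise (c • y) (c • b) := fun m => by
  rw [inner_fockSpace_smul, inner_fockSpace_smul, h m]
  ring

theorem IsLower.add {y b y' b' : fockSpace θ hθ} (h : IsLower y b) (h' : IsLower y' b') :
    IsLower (y + y') (b + b') := fun m => by
  rw [inner_add_right, inner_add_right, h m, h' m]
  ring

theorem IsRaise.add {y b y' b' : fockSpace θ hθ} (h : IsRaise y b) (h' : IsRaise y' b') :
    IsRaise (y + y') (b + b') := fun m => by
  rw [inner_add_right, inner_add_right, h m, h' m]
  ring

/-- The annihilation and the creation operator are formal adjoints, on their maximal domains. -/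
theorem IsLower.inner_eq {y b u b' : fockSpace θ hθ} (h : IsLower y b) (h' : IsRaise u b') :
    ⟪y, b'⟫_ℂ = ⟪b, u⟫_ℂ := by
  have h1 := (fockHilbertBasis hθ).hasSum_inner_mul_inner y b'
  have h2 := (fockHilbertBasis hθ).hasSum_inner_mul_inner b u
  simp only [fockHilbertBasis_apply] at h1 h2
  rw [← hasSum_nat_add_iff' 1] at h1
  simp only [Finset.sum_range_one, h' 0, ladder_zero, Complex.ofReal_zero, zero_mul, mul_zero,
    sub_zero] at h1
  refine h1.unique ?_
  refine h2.congr_fun fun n => ?_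
  rw [h' (n + 1), Nat.add_sub_cancel, ← conj_inner_fockSpace b, h n, map_mul, Complex.conj_ofReal,
    conj_inner_fockSpace]
  ring

/-! ### Toeplitz operators and ladder relations -/

theorem mulOp_ae (f : ℂ →ᵇ ℂ) (u : L2Plane) :
    (mulOp f u : ℂ → ℂ) =ᵐ[planeMeasure] fun z => f z * u z := by
  have h := ContinuousLinearMap.coeFn_holder (r := 2) (ContinuousLinearMap.mul ℂ ℂ)
    ((memLp_top_bcf f).toLp f) u
  filter_upwards [h, (memLp_top_bcf f).coeFn_toLp] with z hz hz'
  rw [mulOp, ContinuousLinearMap.holderL_apply_apply, hz, hz']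
  rfl

theorem inner_toeplitz (f : ℂ →ᵇ ℂ) (x u : fockSpace θ hθ) :
    ⟪x, toeplitz θ hθ f u⟫_ℂ =
      ∫ z, conj ((x : L2Plane) z) * (f z * (u : L2Plane) z) ∂planeMeasure := by
  have h : ⟪x, toeplitz θ hθ f u⟫_ℂ = ⟪(x : L2Plane), mulOp f u⟫_ℂ :=
    Submodule.inner_orthogonalProjectionOnto_eq_of_mem_left _ _
  rw [h, inner_L2Plane]
  refine integral_congr_ae ?_
  filter_upwards [mulOp_ae f u] with z hz
  rw [hz]

theorem inner_fockBasis_toeplitz (f : ℂ →ᵇ ℂ) (n : ℕ) (u : fockSpace θ hθ) :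
    ⟪fockBasis θ hθ n, toeplitz θ hθ f u⟫_ℂ =
      ∫ z, conj (fockFun θ n z) * (f z * (u : L2Plane) z) ∂planeMeasure := by
  rw [inner_toeplitz]
  refine integral_congr_ae ?_
  filter_upwards [fockVec_ae hθ n] with z hz
  rw [← hz]
  rfl

theorem norm_toeplitz_apply_le (f : ℂ →ᵇ ℂ) {C : ℝ} (hC : ∀ z, ‖f z‖ ≤ C)
    (u : fockSpace θ hθ) : ‖toeplitz θ hθ f u‖ ≤ C * ‖u‖ := by
  have h1 : ‖toeplitz θ hθ f u‖ ≤ ‖mulOp f (u : L2Plane)‖ :=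
    Submodule.norm_orthogonalProjectionOnto_apply_le (fockSpace θ hθ) (mulOp f (u : L2Plane))
  have h2 : ‖mulOp f (u : L2Plane)‖ ≤ C * ‖(u : L2Plane)‖ :=
    Lp.norm_le_mul_norm_of_ae_le_mul ?_
  exact h1.trans h2
  filter_upwards [mulOp_ae f u] with z hz
  rw [hz, norm_mul]
  gcongr
  exact hC z

theorem inner_toeplitz_left (f g : ℂ →ᵇ ℂ) (hg : ∀ z, g z = conj (f z)) (x u : fockSpace θ hθ) :
    ⟪toeplitz θ hθ f x, u⟫_ℂ = ⟪x, toeplitz θ hθ g u⟫_ℂ := by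
  rw [← conj_inner_fockSpace, inner_toeplitz, inner_toeplitz, ← integral_conj]
  refine integral_congr_ae (ae_of_all _ fun z => ?_)
  simp only [map_mul, Complex.conj_conj, hg]
  ring

/-- `a π(f) = π(z̄ f)`; the function `g` stands for `z̄ f`. -/
theorem isLower_toeplitz (f g : ℂ →ᵇ ℂ) (hg : ∀ z, g z = conj z * f z) (u : fockSpace θ hθ) :
    IsLower (toeplitz θ hθ f u) (toeplitz θ hθ g u) := by
  intro m
  rw [inner_fockBasis_toeplitz, inner_fockBasis_toeplitz, ← integral_const_mul]
  refine integral_congr_ae (ae_of_all _ fun z => ?_)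
  have h := congrArg conj (mul_fockFun hθ m z)
  simp only [map_mul, Complex.conj_ofReal] at h
  simp only [hg]
  linear_combination (f z * (u : L2Plane) z) * h

theorem integrable_conj_fockFun_mul_fockFun (hθ : 0 < θ) (m n : ℕ) :
    Integrable (fun z => conj (fockFun θ m z) * fockFun θ n z) planeMeasure :=
  ((memLp_fockFun hθ m).star).integrable_mul (memLp_fockFun hθ n)

/-- `a† π(f) = π(z f) - θ π(∂̄ f)`, for a bounded `f` with bounded derivative; the functions `g` and
`f'` stand for `z f` and `∂̄ f`. -/
theorem isRaise_toeplitz (f g f' : ℂ →ᵇ ℂ) (hg : ∀ z, g z = z * f z)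
    (hf : Differentiable ℝ f) (hf' : ∀ z, f' z = dzbar f z) (hfb : ∃ C, ∀ z, ‖fderiv ℝ f z‖ ≤ C)
    (hfc : Continuous (fderiv ℝ f)) (u : fockSpace θ hθ) :
    IsRaise (toeplitz θ hθ f u) (toeplitz θ hθ g u - (θ : ℂ) • toeplitz θ hθ f' u) := by
  have hθ' : (θ : ℂ) ≠ 0 := by exact_mod_cast hθ.ne'
  intro m
  have key : (innerSL ℂ (fockBasis θ hθ m)) ∘L (toeplitz θ hθ g - (θ : ℂ) • toeplitz θ hθ f') =
      (ladder θ m : ℂ) • ((innerSL ℂ (fockBasis θ hθ (m - 1))) ∘L toeplitz θ hθ f) := by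
    refine ContinuousLinearMap.ext_on (dense_span_fockBasis hθ) ?_
    rintro _ ⟨n, rfl⟩
    have hb : ∀ (φ : ℂ →ᵇ ℂ) (k : ℕ), ⟪fockBasis θ hθ k, toeplitz θ hθ φ (fockBasis θ hθ n)⟫_ℂ =
        ∫ z, conj (fockFun θ k z) * fockFun θ n z * φ z ∂planeMeasure := by
      intro φ k
      rw [inner_fockBasis_toeplitz]
      refine integral_congr_ae ?_
      filter_upwards [fockVec_ae hθ n] with z hz
      change conj (fockFun θ k z) * (φ z * fockVec θ hθ n z) = _
      rw [hz]
      ring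
    have hbi : ∀ (φ : ℂ →ᵇ ℂ) (k l : ℕ),
        Integrable (fun z => conj (fockFun θ k z) * fockFun θ l z * φ z) planeMeasure := by
      intro φ k l
      exact (integrable_conj_fockFun_mul_fockFun hθ k l).mul_bdd (c := ‖φ‖)
        φ.continuous.aestronglyMeasurable (ae_of_all _ φ.norm_coe_le_norm)
    set F : ℂ → ℂ := fun z => conj (fockFun θ m z) * fockFun θ n z with hF
    have hW : ∀ z, HasWirt F _ _ z := fun z =>
      (hasWirt_fockFun hθ m z).conj.mul (hasWirt_fockFun hθ n z)
    obtain ⟨C, hC⟩ := hfb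
    have hibp := integral_mul_dzbar (F := F) (G := f) (fun z => (hW z).differentiableAt) hf
      (hbi f m n) (fun v => ?_) (fun v => ?_)
    · have e : ∀ z, dzbar F z * f z = (ladder θ m : ℂ) / θ *
          (conj (fockFun θ (m - 1) z) * fockFun θ n z * f z) - 1 / θ * (F z * g z) := by
        intro z
        rw [(hW z).dzbar_eq, hg]
        simp only [hF, map_sub, map_mul, map_div₀, map_one, Complex.conj_ofReal, Complex.conj_conj,
          Complex.conj_ofNat]
        field_simp
        ring
      simp_rw [e] at hibp
      rw [integral_sub ((hbi f (m - 1) n).const_mul _) ((hbi g m n).const_mul _),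
        integral_const_mul, integral_const_mul] at hibp
      have e2 : ∫ z, F z * f' z ∂planeMeasure = ∫ z, F z * dzbar f z ∂planeMeasure := by
        simp_rw [hf']
      simp only [ContinuousLinearMap.comp_apply, innerSL_apply_apply,
        sub_apply, smul_apply, inner_sub_right, inner_fockSpace_smul, hb, smul_eq_mul]
      change ∫ z, F z * g z ∂planeMeasure - θ * ∫ z, F z * f' z ∂planeMeasure = _
      rw [e2, hibp]
      field_simp
      ring
    · have e : ∀ z, fderiv ℝ F z v * f z =
          (v * (ladder θ n / θ)) * (conj (fockFun θ m z) * fockFun θ (n - 1) z * f z) +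
          (-v * (ladder θ (m + 1) / θ)) * (conj (fockFun θ (m + 1) z) * fockFun θ n z * f z) +
          (-conj v * (ladder θ (n + 1) / θ)) * (conj (fockFun θ m z) * fockFun θ (n + 1) z * f z) +
          (conj v * (ladder θ m / θ)) * (conj (fockFun θ (m - 1) z) * fockFun θ n z * f z) := by
        intro z
        have h1 := congrArg conj (mul_fockFun hθ m z)
        have h2 := mul_fockFun hθ n z
        simp only [map_mul, Complex.conj_ofReal] at h1
        rw [(hW z).fderiv]
        simp only [wirtMap_apply, map_sub, map_mul, map_neg, map_div₀, map_one, Complex.conj_ofReal,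
          Complex.conj_conj, Complex.conj_ofNat]
        field_simp
        linear_combination (-2 * fockFun θ n z * f z * v) * h1 -
          (2 * conj (fockFun θ m z) * f z * conj v) * h2
      simp_rw [e]
      exact ((((hbi f m (n - 1)).const_mul _).add ((hbi f (m + 1) n).const_mul _)).add
        ((hbi f m (n + 1)).const_mul _)).add ((hbi f (m - 1) n).const_mul _)
    · refine (integrable_conj_fockFun_mul_fockFun hθ m n).mul_bdd (c := C * ‖v‖) ?_ ?_
      · exact (hfc.clm_apply continuous_const).aestronglyMeasurable
      · refine ae_of_all _ fun z => ((fderiv ℝ f z).le_opNorm v).trans ?_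
        gcongr
        exact hC z
  have := congrArg (fun A => A u) key
  simpa using this

end ladder

/-! ### Weak derivatives on the Fock space -/

section weak

variable {θ : ℝ} {hθ : 0 < θ}

theorem inner_toLp_star {φ : ℂ → ℂ} (hφ : MemLp φ 2 planeMeasure) (u : L2Plane) :
    ⟪hφ.star.toLp _, u⟫_ℂ = ∫ z, u z * φ z ∂planeMeasure := by
  rw [inner_L2Plane]
  refine integral_congr_ae ?_
  filter_upwards [hφ.star.coeFn_toLp] with z hz
  rw [hz, mul_comm]
  simp

theorem hasSum_integral_mul (y : fockSpace θ hθ) {φ : ℂ → ℂ} (hφ : MemLp φ 2 planeMeasure) :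
    HasSum (fun n => ⟪fockBasis θ hθ n, y⟫_ℂ * ∫ z, fockFun θ n z * φ z ∂planeMeasure)
      (∫ z, (y : L2Plane) z * φ z ∂planeMeasure) := by
  have h := (hasSum_fockBasis hθ y).mapL
    (innerSL ℂ (hφ.star.toLp _) ∘L (fockSpace θ hθ).subtypeL)
  have e : ∀ x : fockSpace θ hθ, (innerSL ℂ (hφ.star.toLp _) ∘L (fockSpace θ hθ).subtypeL) x =
      ∫ z, (x : L2Plane) z * φ z ∂planeMeasure := fun x => inner_toLp_star hφ _
  rw [e] at h
  refine h.congr_fun fun n => ?_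
  rw [map_smul, e, smul_eq_mul]
  congr 1
  refine integral_congr_ae ?_
  filter_upwards [fockVec_ae hθ n] with z hz
  rw [← hz]
  rfl

/-- Integration against `φ` of the relation `b = a† y`. -/
theorem IsRaise.hasSum {y b : fockSpace θ hθ} (h : IsRaise y b) {φ : ℂ → ℂ}
    (hφ : MemLp φ 2 planeMeasure) :
    HasSum (fun n => ⟪fockBasis θ hθ n, y⟫_ℂ *
      (ladder θ (n + 1) * ∫ z, fockFun θ (n + 1) z * φ z ∂planeMeasure))
      (∫ z, (b : L2Plane) z * φ z ∂planeMeasure) := by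
  have h1 := hasSum_integral_mul b hφ
  rw [← hasSum_nat_add_iff' 1] at h1
  simp only [Finset.sum_range_one, h 0, ladder_zero, Complex.ofReal_zero, zero_mul,
    sub_zero] at h1
  refine h1.congr_fun fun n => ?_
  rw [h (n + 1), Nat.add_sub_cancel]
  ring

/-- Integration against `φ` of the relation `b = a y`. -/
theorem IsLower.hasSum {y b : fockSpace θ hθ} (h : IsLower y b) {φ : ℂ → ℂ}
    (hφ : MemLp φ 2 planeMeasure) :
    HasSum (fun n => ⟪fockBasis θ hθ n, y⟫_ℂ *
      (ladder θ n * ∫ z, fockFun θ (n - 1) z * φ z ∂planeMeasure))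
      (∫ z, (b : L2Plane) z * φ z ∂planeMeasure) := by
  have h1 := hasSum_integral_mul b hφ
  rw [← hasSum_nat_add_iff' 1]
  simp only [Finset.sum_range_one, ladder_zero, Complex.ofReal_zero, zero_mul, mul_zero,
    sub_zero]
  refine h1.congr_fun fun n => ?_
  rw [h n, Nat.add_sub_cancel]
  ring

theorem integral_fockFun_mul_dzbar (hθ : 0 < θ) (n : ℕ) {φ : ℂ → ℂ} (h : ContDiff ℝ ∞ φ)
    (h' : HasCompactSupport φ) :
    ∫ z, fockFun θ n z * dzbar φ z ∂planeMeasure =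
      1 / (2 * θ) * (ladder θ (n + 1) * ∫ z, fockFun θ (n + 1) z * φ z ∂planeMeasure) := by
  have hc := (contDiff_fockFun θ n).continuous_fderiv (by simp)
  have hd := h.continuous_fderiv (by simp)
  rw [integral_mul_dzbar ((contDiff_fockFun θ n).differentiable (by simp))
    (h.differentiable (by simp))]
  · simp_rw [dzbar_fockFun hθ, mul_assoc]
    rw [integral_const_mul, integral_const_mul]
    ring
  · exact ((continuous_fockFun θ n).mul h.continuous).integrable_of_hasCompactSupport h'.mul_left
  · exact fun v => ((hc.clm_apply continuous_const).mul
      h.continuous).integrable_of_hasCompactSupport h'.mul_left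
  · exact fun v => ((continuous_fockFun θ n).mul
      (hd.clm_apply continuous_const)).integrable_of_hasCompactSupport
      (h'.fderiv_apply (𝕜 := ℝ) v).mul_left

theorem integral_fockFun_mul_dz (hθ : 0 < θ) (n : ℕ) {φ : ℂ → ℂ} (h : ContDiff ℝ ∞ φ)
    (h' : HasCompactSupport φ) :
    ∫ z, fockFun θ n z * dz φ z ∂planeMeasure =
      -(1 / θ * (ladder θ n * ∫ z, fockFun θ (n - 1) z * φ z ∂planeMeasure)) +
      1 / (2 * θ) * ∫ z, fockFun θ n z * (conj z * φ z) ∂planeMeasure := by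
  have hc := (contDiff_fockFun θ n).continuous_fderiv (by simp)
  have hd := h.continuous_fderiv (by simp)
  rw [integral_mul_dz ((contDiff_fockFun θ n).differentiable (by simp))
    (h.differentiable (by simp))]
  · have e : ∀ z, dz (fockFun θ n) z * φ z = (ladder θ n : ℂ) / θ * (fockFun θ (n - 1) z * φ z) -
        1 / (2 * θ) * (fockFun θ n z * (conj z * φ z)) := fun z => by
      rw [dz_fockFun hθ]
      ring
    simp_rw [e]
    rw [integral_sub, integral_const_mul, integral_const_mul]
    · ring
    · exact (((continuous_fockFun θ (n - 1)).mul
        h.continuous).integrable_of_hasCompactSupport h'.mul_left).const_mul _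
    · exact (((continuous_fockFun θ n).mul
        (Complex.continuous_conj.mul h.continuous)).integrable_of_hasCompactSupport
        h'.mul_left.mul_left).const_mul _
  · exact ((continuous_fockFun θ n).mul h.continuous).integrable_of_hasCompactSupport h'.mul_left
  · exact fun v => ((hc.clm_apply continuous_const).mul
      h.continuous).integrable_of_hasCompactSupport h'.mul_left
  · exact fun v => ((continuous_fockFun θ n).mul
      (hd.clm_apply continuous_const)).integrable_of_hasCompactSupport
      (h'.fderiv_apply (𝕜 := ℝ) v).mul_left

/-- On the domain of the creation operator, `∂̄ = -(2 θ)⁻¹ a†` weakly. -/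
theorem IsRaise.isWeakDzbar {y b : fockSpace θ hθ} (h : IsRaise y b) :
    IsWeakDzbar (y : L2Plane) ((-(1 / (2 * θ)) : ℂ) • (b : L2Plane)) := by
  intro φ hφ hφ'
  have h1 := hasSum_integral_mul y (memLp_test (continuous_dzbar hφ) (hasCompactSupport_dzbar hφ'))
  have h2 := (h.hasSum (memLp_test hφ.continuous hφ')).mul_left (1 / (2 * θ) : ℂ)
  rw [integral_smul_mul, neg_mul, neg_neg]
  refine h1.unique (h2.congr_fun fun n => ?_)
  rw [integral_fockFun_mul_dzbar hθ n hφ hφ']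
  ring

/-- On the domain of the creation operator, `a†` is multiplication by `z`. -/
theorem IsRaise.ae_eq {y b : fockSpace θ hθ} (h : IsRaise y b) :
    ((b : L2Plane) : ℂ → ℂ) =ᵐ[planeMeasure] fun z => z * (y : L2Plane) z := by
  have hloc : LocallyIntegrable (fun z => (b : L2Plane) z - z * (y : L2Plane) z) planeMeasure :=
    ((Lp.memLp (b : L2Plane)).locallyIntegrable (by norm_num)).sub
      (((Lp.memLp (y : L2Plane)).locallyIntegrable (by norm_num)).continuous_mul continuous_id)
  have key : ∀ᵐ z ∂planeMeasure, (b : L2Plane) z - z * (y : L2Plane) z = 0 := by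
    refine ae_eq_zero_of_integral_contDiff_smul_eq_zero hloc fun g hg hg' => ?_
    have hφ : ContDiff ℝ ∞ (fun z => (g z : ℂ)) := Complex.ofRealCLM.contDiff.comp hg
    have hφ' : HasCompactSupport (fun z => (g z : ℂ)) :=
      hg'.comp_left (g := ((↑) : ℝ → ℂ)) (by simp)
    have hψ : Continuous (fun z => z * (g z : ℂ)) := continuous_id.mul hφ.continuous
    have hψ' : HasCompactSupport (fun z => z * (g z : ℂ)) := hφ'.mul_left
    have h1 := h.hasSum (memLp_test hφ.continuous hφ')
    have h2 := hasSum_integral_mul y (memLp_test hψ hψ')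
    have h3 := h1.unique (h2.congr_fun fun n => by
      rw [← integral_const_mul]
      congr 2 with z
      linear_combination (-(g z : ℂ)) * mul_fockFun hθ n z)
    have e : ∀ z, g z • ((b : L2Plane) z - z * (y : L2Plane) z) =
        (b : L2Plane) z * (g z : ℂ) - (y : L2Plane) z * (z * (g z : ℂ)) := fun z => by
      rw [Complex.real_smul]
      ring
    simp_rw [e]
    rw [integral_sub (integrable_mul_test _ hφ.continuous hφ') (integrable_mul_test _ hψ hψ'), h3,
      sub_self]
  filter_upwards [key] with z hz
  exact sub_eq_zero.1 hz

theorem IsRaise.memLp_conj_mul {y b : fockSpace θ hθ} (h : IsRaise y b) :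
    MemLp (fun z => conj z * (y : L2Plane) z) 2 planeMeasure := by
  refine (Lp.memLp (b : L2Plane)).mono
    (Complex.continuous_conj.aestronglyMeasurable.mul (Lp.aestronglyMeasurable _)) ?_
  filter_upwards [h.ae_eq] with z hz
  simp [hz]

/-- If `y` is in the domain of both ladder operators, then `∂ y = θ⁻¹ a y - (2 θ)⁻¹ z̄ y` weakly. -/
theorem IsLower.isWeakDz {y b b' : fockSpace θ hθ} (h : IsLower y b) (h' : IsRaise y b') :
    IsWeakDz (y : L2Plane) ((1 / θ : ℂ) • (b : L2Plane) +
      (-(1 / (2 * θ)) : ℂ) • h'.memLp_conj_mul.toLp _) := by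
  intro φ hφ hφ'
  have hψ : Continuous (fun z => conj z * φ z) := Complex.continuous_conj.mul hφ.continuous
  have hψ' : HasCompactSupport (fun z => conj z * φ z) := hφ'.mul_left
  have h1 := hasSum_integral_mul y (memLp_test (continuous_dz hφ) (hasCompactSupport_dz hφ'))
  have h2 := (h.hasSum (memLp_test hφ.continuous hφ')).mul_left (-(1 / θ) : ℂ)
  have h3 := (hasSum_integral_mul y (memLp_test hψ hψ')).mul_left (1 / (2 * θ) : ℂ)
  have e : ∫ z, (h'.memLp_conj_mul.toLp _ : L2Plane) z * φ z ∂planeMeasure =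
      ∫ z, (y : L2Plane) z * (conj z * φ z) ∂planeMeasure := by
    refine integral_congr_ae ?_
    filter_upwards [h'.memLp_conj_mul.coeFn_toLp] with z hz
    rw [hz]
    ring
  rw [integral_add_mul _ _ hφ.continuous hφ', integral_smul_mul, integral_smul_mul, e, neg_add,
    neg_mul, neg_neg, ← neg_mul]
  refine h1.unique ((h2.add h3).congr_fun fun n => ?_)
  rw [integral_fockFun_mul_dz hθ n hφ hφ']
  ring

/-! ### Weak derivatives against square integrable functions -/

/-- A smooth cutoff function, equal to one on the unit disk. -/
def cutoff : ContDiffBump (0 : ℂ) := ⟨1, 2, one_pos, one_lt_two⟩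

/-- The weak equation `D u = g`, where `D` is `∂` for `c = -I` and `∂̄` for `c = I`, extends from
compactly supported test functions to smooth functions that are square integrable together with
their derivative, by cutting off at radius `k + 1` and letting `k` tend to infinity. -/
theorem weak_derivative_extend (c : ℂ) {u g : L2Plane}
    (h : ∀ φ : ℂ → ℂ, ContDiff ℝ ∞ φ → HasCompactSupport φ →
      ∫ z, u z * ((fderiv ℝ φ z 1 + c * fderiv ℝ φ z Complex.I) / 2) ∂planeMeasure =
        -∫ z, g z * φ z ∂planeMeasure)
    {η : ℂ → ℂ} (hη : ContDiff ℝ ∞ η) (h0 : MemLp η 2 planeMeasure)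
    (h1 : MemLp (fun z => (fderiv ℝ η z 1 + c * fderiv ℝ η z Complex.I) / 2) 2 planeMeasure) :
    ∫ z, u z * ((fderiv ℝ η z 1 + c * fderiv ℝ η z Complex.I) / 2) ∂planeMeasure =
      -∫ z, g z * η z ∂planeMeasure := by
  set χ : ℂ → ℂ := fun z => (cutoff z : ℂ) with hχ
  have hχs : ContDiff ℝ ∞ χ := Complex.ofRealCLM.contDiff.comp cutoff.contDiff
  have hχc : HasCompactSupport χ :=
    cutoff.hasCompactSupport.comp_left (g := ((↑) : ℝ → ℂ)) (by simp)
  have hχ1 : ∀ z, ‖χ z‖ ≤ 1 := fun z => by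
    rw [hχ, Complex.norm_real, Real.norm_eq_abs, abs_of_nonneg cutoff.nonneg]
    exact cutoff.le_one
  obtain ⟨C, hC⟩ := (hχs.continuous_fderiv (by simp)).bounded_above_of_compact_support
    (hχc.fderiv (𝕜 := ℝ))
  have hC0 : 0 ≤ C := (norm_nonneg _).trans (hC 0)
  set L : (ℂ →L[ℝ] ℂ) → ℂ := fun A => (A 1 + c * A Complex.I) / 2 with hL
  have hLb : ∀ A : ℂ →L[ℝ] ℂ, ‖L A‖ ≤ ((1 + ‖c‖) / 2) * ‖A‖ := fun A => by
    have e1 := A.le_opNorm 1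
    have e2 := A.le_opNorm Complex.I
    simp only [norm_one, mul_one, Complex.norm_I] at e1 e2
    rw [hL, norm_div, Complex.norm_ofNat]
    have := norm_add_le (A 1) (c * A Complex.I)
    rw [norm_mul] at this
    nlinarith [norm_nonneg c, mul_le_mul_of_nonneg_left e2 (norm_nonneg c)]
  set r : ℕ → ℝ := fun k => ((k : ℝ) + 1)⁻¹ with hr
  have hr0 : ∀ k, 0 < r k := fun k => by positivity
  have hr1 : ∀ k, r k ≤ 1 := fun k => inv_le_one_of_one_le₀ (by simp)
  have hrt : Tendsto r atTop (𝓝 0) := tendsto_inv_atTop_zero.comp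
    (tendsto_atTop_add_const_right _ _ tendsto_natCast_atTop_atTop)
  have hsc : ∀ k z, HasFDerivAt (fun w => χ (r k • w)) (r k • fderiv ℝ χ (r k • z)) z := by
    intro k z
    have := ((hχs.differentiable (by simp) (r k • z)).hasFDerivAt).comp z
      ((hasFDerivAt_id z).const_smul (r k))
    refine this.congr_fderiv ?_
    ext w
    simp
  set φ : ℕ → ℂ → ℂ := fun k z => χ (r k • z) * η z with hφ
  have hφd : ∀ k z, L (fderiv ℝ (φ k) z) =
      χ (r k • z) * L (fderiv ℝ η z) + r k * L (fderiv ℝ χ (r k • z)) * η z := by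
    intro k z
    have := HasFDerivAt.mul (hsc k z) (hη.differentiable (by simp) z).hasFDerivAt
    have e : fderiv ℝ (φ k) z = _ := this.fderiv
    rw [e]
    simp [hL]
    ring
  have hφs : ∀ k, ContDiff ℝ ∞ (φ k) := fun k =>
    (hχs.comp (contDiff_const_smul (r k))).mul hη
  have hφc : ∀ k, HasCompactSupport (φ k) := fun k =>
    (hχc.comp_smul (hr0 k).ne').mul_right
  have hev : ∀ z, ∀ᶠ k in atTop, χ (r k • z) = 1 := by
    intro z
    have ht : Tendsto (fun k => r k • z) atTop (𝓝 0) := by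
      simpa using hrt.smul_const z
    have hn : ∀ᶠ w in 𝓝 (0 : ℂ), χ w = 1 := by
      filter_upwards [cutoff.eventuallyEq_one] with w hw
      simp [hχ, hw]
    exact ht.eventually hn
  have hχt : ∀ z, Tendsto (fun k => χ (r k • z)) atTop (𝓝 1) := fun z =>
    tendsto_const_nhds.congr' ((hev z).mono fun k hk => hk.symm)
  have hLη : Continuous fun z => L (fderiv ℝ η z) := by
    have := hη.continuous_fderiv (by simp)
    simp only [hL]
    fun_prop
  have hLφ : ∀ k, Continuous fun z => L (fderiv ℝ (φ k) z) := fun k => by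
    have := (hφs k).continuous_fderiv (by simp)
    simp only [hL]
    fun_prop
  have t1 : Tendsto (fun k => ∫ z, g z * φ k z ∂planeMeasure) atTop
      (𝓝 (∫ z, g z * η z ∂planeMeasure)) := by
    refine tendsto_integral_of_dominated_convergence (fun z => ‖g z * η z‖) (fun k => ?_)
      ((Lp.memLp g).integrable_mul h0).norm (fun k => ae_of_all _ fun z => ?_)
      (ae_of_all _ fun z => ?_)
    · exact (Lp.aestronglyMeasurable g).mul (hφs k).continuous.aestronglyMeasurable
    · rw [hφ, norm_mul, norm_mul, norm_mul]
      nlinarith [mul_le_mul_of_nonneg_right (hχ1 (r k • z))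
        (mul_nonneg (norm_nonneg (g z)) (norm_nonneg (η z)))]
    · have := ((hχt z).mul_const (η z)).const_mul (g z)
      rwa [one_mul] at this
  have t2 : Tendsto (fun k => ∫ z, u z * L (fderiv ℝ (φ k) z) ∂planeMeasure) atTop
      (𝓝 (∫ z, u z * L (fderiv ℝ η z) ∂planeMeasure)) := by
    refine tendsto_integral_of_dominated_convergence
      (fun z => ‖u z * L (fderiv ℝ η z)‖ + ((1 + ‖c‖) / 2 * C) * ‖u z * η z‖) (fun k => ?_)
      (((Lp.memLp u).integrable_mul h1).norm.add
        (((Lp.memLp u).integrable_mul h0).norm.const_mul _)) (fun k => ae_of_all _ fun z => ?_)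
      (ae_of_all _ fun z => ?_)
    · exact (Lp.aestronglyMeasurable u).mul (hLφ k).aestronglyMeasurable
    · rw [hφd, mul_add]
      refine (norm_add_le _ _).trans (add_le_add ?_ ?_)
      · rw [norm_mul, norm_mul, norm_mul]
        have := mul_le_mul_of_nonneg_left (hχ1 (r k • z))
          (mul_nonneg (norm_nonneg (u z)) (norm_nonneg (L (fderiv ℝ η z))))
        linarith
      · rw [norm_mul, norm_mul, norm_mul, norm_mul, Complex.norm_real, Real.norm_eq_abs,
          abs_of_pos (hr0 k)]
        have b1 : ‖L (fderiv ℝ χ (r k • z))‖ ≤ (1 + ‖c‖) / 2 * C :=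
          (hLb _).trans (mul_le_mul_of_nonneg_left (hC _) (by positivity))
        have b2 : r k * ‖L (fderiv ℝ χ (r k • z))‖ ≤ 1 * ((1 + ‖c‖) / 2 * C) :=
          mul_le_mul (hr1 k) b1 (norm_nonneg _) zero_le_one
        have := mul_le_mul_of_nonneg_left b2
          (mul_nonneg (norm_nonneg (u z)) (norm_nonneg (η z)))
        linarith
    · have hz : Tendsto (fun k => (r k : ℂ) * L (fderiv ℝ χ (r k • z))) atTop (𝓝 0) := by
        refine squeeze_zero_norm (a := fun k => r k * ((1 + ‖c‖) / 2 * C)) (fun k => ?_) ?_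
        · rw [norm_mul, Complex.norm_real, Real.norm_eq_abs, abs_of_pos (hr0 k)]
          exact mul_le_mul_of_nonneg_left
            ((hLb _).trans (mul_le_mul_of_nonneg_left (hC _) (by positivity))) (hr0 k).le
        · simpa using hrt.mul_const ((1 + ‖c‖) / 2 * C)
      have := (((hχt z).mul_const (L (fderiv ℝ η z))).add (hz.mul_const (η z))).const_mul (u z)
      simp only [one_mul, zero_mul, add_zero] at this
      simpa only [hφd] using this
  refine tendsto_nhds_unique t2 ?_
  exact t1.neg.congr fun k => (h _ (hφs k) (hφc k)).symm

theorem memLp_conj_fockFun (hθ : 0 < θ) (n : ℕ) :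
    MemLp (fun z => conj (fockFun θ n z)) 2 planeMeasure := (memLp_fockFun hθ n).star

theorem memLp_mul_conj_fockFun (hθ : 0 < θ) (n : ℕ) :
    MemLp (fun z => z * conj (fockFun θ n z)) 2 planeMeasure := by
  refine ((memLp_fockFun hθ (n + 1)).const_mul (ladder θ (n + 1) : ℂ)).mono ?_
    (ae_of_all _ fun z => ?_)
  · exact (continuous_id.mul
      (Complex.continuous_conj.comp (continuous_fockFun θ n))).aestronglyMeasurable
  · rw [← mul_fockFun hθ]
    simp

theorem contDiff_conj_fockFun (θ : ℝ) (n : ℕ) : ContDiff ℝ ∞ (fun z => conj (fockFun θ n z)) :=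
  (Complex.conjCLE : ℂ →L[ℝ] ℂ).contDiff.comp (contDiff_fockFun θ n)

/-- If `g = ∂ u` weakly with `u` in `H_θ`, then `a u = 2 θ P_θ g`. -/
theorem isLower_of_isWeakDz {u : fockSpace θ hθ} {g : L2Plane} (h : IsWeakDz (u : L2Plane) g) :
    IsLower u ((2 * θ : ℂ) • fockProj θ hθ g) := by
  have hθ' : (θ : ℂ) ≠ 0 := by exact_mod_cast hθ.ne'
  intro m
  have e := weak_derivative_extend (-Complex.I) (u := u) (g := g)
    (fun φ h1 h2 => by simpa only [neg_mul, ← sub_eq_add_neg, dz] using h φ h1 h2)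
    (contDiff_conj_fockFun θ m) (memLp_conj_fockFun hθ m)
  simp only [neg_mul, ← sub_eq_add_neg] at e
  change MemLp (dz (fun w => conj (fockFun θ m w))) 2 planeMeasure →
    ∫ z, (u : L2Plane) z * dz (fun w => conj (fockFun θ m w)) z ∂planeMeasure = _ at e
  have e0 : dz (fun w => conj (fockFun θ m w)) = fun z =>
      -(1 / (2 * θ) : ℂ) * (ladder θ (m + 1) * conj (fockFun θ (m + 1) z)) :=
    funext (dz_conj_fockFun hθ m)
  rw [e0] at e
  have e1 := e (((memLp_conj_fockFun hθ (m + 1)).const_mul _).const_mul _)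
  have e2 : ∀ z, (u : L2Plane) z * (-(1 / (2 * θ) : ℂ) *
      (ladder θ (m + 1) * conj (fockFun θ (m + 1) z))) = -(1 / (2 * θ) : ℂ) * ladder θ (m + 1) *
      (conj (fockFun θ (m + 1) z) * (u : L2Plane) z) := fun z => by ring
  have e3 : ⟪fockBasis θ hθ (m + 1), u⟫_ℂ =
      ∫ z, conj (fockFun θ (m + 1) z) * (u : L2Plane) z ∂planeMeasure := inner_fockVec hθ _ _
  simp_rw [e2, mul_comm (g _)] at e1
  rw [integral_const_mul, ← e3, ← inner_fockVec hθ] at e1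
  rw [inner_fockSpace_smul, inner_fockBasis_proj]
  field_simp at e1
  linear_combination e1

/-- If `g = ∂̄ u` weakly with `u` in `H_θ`, then `a† u = -2 θ P_θ g`. -/
theorem isRaise_of_isWeakDzbar {u : fockSpace θ hθ} {g : L2Plane}
    (h : IsWeakDzbar (u : L2Plane) g) :
    IsRaise u ((-(2 * θ) : ℂ) • fockProj θ hθ g) := by
  have hθ' : (θ : ℂ) ≠ 0 := by exact_mod_cast hθ.ne'
  intro m
  have hM1 := memLp_conj_fockFun hθ (m - 1)
  have hM2 := memLp_mul_conj_fockFun hθ m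
  have e0 : dzbar (fun w => conj (fockFun θ m w)) = fun z =>
      (ladder θ m : ℂ) / θ * conj (fockFun θ (m - 1) z) -
      1 / (2 * θ) * (z * conj (fockFun θ m z)) :=
    funext (dzbar_conj_fockFun hθ m)
  have e1 : ∫ z, (u : L2Plane) z * dzbar (fun w => conj (fockFun θ m w)) z ∂planeMeasure =
      -∫ z, g z * conj (fockFun θ m z) ∂planeMeasure := by
    refine weak_derivative_extend Complex.I h (contDiff_conj_fockFun θ m)
      (memLp_conj_fockFun hθ m) ?_
    change MemLp (dzbar (fun w => conj (fockFun θ m w))) 2 planeMeasure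
    rw [e0]
    exact (hM1.const_mul _).sub (hM2.const_mul _)
  have e2 : ∀ z, (u : L2Plane) z * ((ladder θ m : ℂ) / θ * conj (fockFun θ (m - 1) z) -
      1 / (2 * θ) * (z * conj (fockFun θ m z))) =
      (ladder θ m : ℂ) / θ * ((u : L2Plane) z * conj (fockFun θ (m - 1) z)) -
      1 / (2 * θ) * ((u : L2Plane) z * (z * conj (fockFun θ m z))) := fun z => by ring
  -- Since `z h_n = κ_{n+1} h_{n+1}`, only `n = m - 1` contributes to the expansion of `u`.
  have e3 : ∫ z, (u : L2Plane) z * (z * conj (fockFun θ m z)) ∂planeMeasure =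
      ladder θ m * ⟪fockBasis θ hθ (m - 1), u⟫_ℂ := by
    refine (hasSum_integral_mul u hM2).unique ?_
    have hs : ∀ n, ∫ z, fockFun θ n z * (z * conj (fockFun θ m z)) ∂planeMeasure =
        if n + 1 = m then (ladder θ m : ℂ) else 0 := by
      intro n
      have a1 : ∀ z, fockFun θ n z * (z * conj (fockFun θ m z)) =
          ladder θ (n + 1) * (conj (fockFun θ m z) * fockFun θ (n + 1) z) := fun z => by
        linear_combination conj (fockFun θ m z) * mul_fockFun hθ n z
      have a2 : ∫ z, conj (fockFun θ m z) * fockFun θ (n + 1) z ∂planeMeasure =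
          if m = n + 1 then 1 else 0 := by
        rw [← inner_fockBasis_fockBasis hθ]
        refine Eq.trans ?_ (inner_fockVec hθ m (fockVec θ hθ (n + 1))).symm
        refine integral_congr_ae ?_
        filter_upwards [fockVec_ae hθ (n + 1)] with z hz
        rw [hz]
      simp_rw [a1]
      rw [integral_const_mul, a2]
      by_cases hmn : n + 1 = m
      · subst hmn
        simp
      · rw [if_neg hmn, if_neg (Ne.symm hmn), mul_zero]
    simp_rw [hs]
    cases m with
    | zero => simp
    | succ k =>
      refine (hasSum_ite_eq k ((ladder θ (k + 1) : ℂ) * ⟪fockBasis θ hθ k, u⟫_ℂ)).congr_fun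
        fun n => ?_
      by_cases hn : n = k
      · subst hn
        simp [mul_comm]
      · rw [if_neg hn, if_neg (by omega), mul_zero]
  have e4 : ⟪fockBasis θ hθ (m - 1), u⟫_ℂ =
      ∫ z, (u : L2Plane) z * conj (fockFun θ (m - 1) z) ∂planeMeasure := by
    simp_rw [mul_comm ((u : L2Plane) _)]
    exact inner_fockVec hθ _ _
  rw [e0] at e1
  simp_rw [e2, mul_comm (g _)] at e1
  have i1 : Integrable (fun z => (u : L2Plane) z * conj (fockFun θ (m - 1) z)) planeMeasure :=
    (Lp.memLp (u : L2Plane)).integrable_mul hM1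
  have i2 : Integrable (fun z => (u : L2Plane) z * (z * conj (fockFun θ m z))) planeMeasure :=
    (Lp.memLp (u : L2Plane)).integrable_mul hM2
  rw [integral_sub (i1.const_mul _) (i2.const_mul _),
    integral_const_mul, integral_const_mul, e3, ← e4, ← inner_fockVec hθ] at e1
  rw [inner_fockSpace_smul, inner_fockBasis_proj]
  field_simp at e1
  linear_combination (-1 : ℂ) * e1

end weak

/-! ### The truncated Dirac operator and its commutators -/

section symbols

open scoped LineDeriv

/-- The Schwartz function `z f(z)`. -/
def mulZ (f : 𝓢(ℂ, ℂ)) : 𝓢(ℂ, ℂ) := SchwartzMap.smulLeftCLM ℂ (fun z : ℂ => z) f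

/-- The Schwartz function `z̄ f(z)`. -/
def mulZbar (f : 𝓢(ℂ, ℂ)) : 𝓢(ℂ, ℂ) := SchwartzMap.smulLeftCLM ℂ (fun z : ℂ => conj z) f

/-- The Schwartz function `∂f`. -/
def schwartzDz (f : 𝓢(ℂ, ℂ)) : 𝓢(ℂ, ℂ) :=
  (1 / 2 : ℂ) • (∂_{(1 : ℂ)} f - Complex.I • ∂_{Complex.I} f)

/-- The Schwartz function `∂̄f`. -/
def schwartzDzbar (f : 𝓢(ℂ, ℂ)) : 𝓢(ℂ, ℂ) :=
  (1 / 2 : ℂ) • (∂_{(1 : ℂ)} f + Complex.I • ∂_{Complex.I} f)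

theorem mulZ_apply (f : 𝓢(ℂ, ℂ)) (z : ℂ) : mulZ f z = z * f z :=
  SchwartzMap.smulLeftCLM_apply_apply Function.HasTemperateGrowth.id' f z

theorem mulZbar_apply (f : 𝓢(ℂ, ℂ)) (z : ℂ) : mulZbar f z = conj z * f z :=
  SchwartzMap.smulLeftCLM_apply_apply
    (Complex.conjCLE : ℂ →L[ℝ] ℂ).hasTemperateGrowth f z

theorem schwartzDz_apply (f : 𝓢(ℂ, ℂ)) (z : ℂ) : schwartzDz f z = dz f z := by
  simp only [schwartzDz, smul_apply, sub_apply, smul_eq_mul,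
    SchwartzMap.lineDerivOp_apply_eq_fderiv, dz]
  ring

theorem schwartzDzbar_apply (f : 𝓢(ℂ, ℂ)) (z : ℂ) : schwartzDzbar f z = dzbar f z := by
  simp only [schwartzDzbar, smul_apply, add_apply, smul_eq_mul,
    SchwartzMap.lineDerivOp_apply_eq_fderiv, dzbar]
  ring

theorem conj_fderiv_of_real {f : 𝓢(ℂ, ℂ)} (hf : ∀ z, conj (f z) = f z) (z v : ℂ) :
    conj (fderiv ℝ f z v) = fderiv ℝ f z v := by
  have h := (Complex.conjCLE : ℂ →L[ℝ] ℂ).hasFDerivAt.comp z (f.hasFDerivAt z)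
  have e : (Complex.conjCLE : ℂ →L[ℝ] ℂ) ∘ f = f := funext hf
  rw [e] at h
  have h' := h.unique (f.hasFDerivAt z)
  exact congrArg (fun A : ℂ →L[ℝ] ℂ => A v) h'

theorem conj_dzbar_of_real {f : 𝓢(ℂ, ℂ)} (hf : ∀ z, conj (f z) = f z) (z : ℂ) :
    conj (dzbar f z) = dz f z := by
  simp only [dzbar, dz, map_div₀, map_add, map_mul, conj_fderiv_of_real hf, Complex.conj_I,
    Complex.conj_ofNat]
  ring

end symbols

/-- The Toeplitz operator of a Schwartz function. -/
abbrev schwartzToeplitz {θ : ℝ} (hθ : 0 < θ) (f : 𝓢(ℂ, ℂ)) :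
    fockSpace θ hθ →L[ℂ] fockSpace θ hθ :=
  toeplitz θ hθ f.toBoundedContinuousFunction

section

variable {θ : ℝ} {hθ : 0 < θ}

theorem isLower_schwartzToeplitz (f : 𝓢(ℂ, ℂ)) (u : fockSpace θ hθ) :
    IsLower (schwartzToeplitz hθ f u) (schwartzToeplitz hθ (mulZbar f) u) :=
  isLower_toeplitz _ _ (mulZbar_apply f) u

theorem isRaise_schwartzToeplitz (f : 𝓢(ℂ, ℂ)) (u : fockSpace θ hθ) :
    IsRaise (schwartzToeplitz hθ f u) (schwartzToeplitz hθ (mulZ f) u -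
      (θ : ℂ) • schwartzToeplitz hθ (schwartzDzbar f) u) := by
  have hb : ∀ z, ‖fderiv ℝ f z‖ ≤
      ‖(SchwartzMap.fderivCLM ℝ ℂ ℂ f).toBoundedContinuousFunction‖ :=
    (SchwartzMap.fderivCLM ℝ ℂ ℂ f).toBoundedContinuousFunction.norm_coe_le_norm
  have hc : Continuous (fderiv ℝ f) := (SchwartzMap.fderivCLM ℝ ℂ ℂ f).continuous
  exact isRaise_toeplitz f.toBoundedContinuousFunction (mulZ f).toBoundedContinuousFunction
    (schwartzDzbar f).toBoundedContinuousFunction (mulZ_apply f) f.differentiable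
    (schwartzDzbar_apply f) ⟨_, hb⟩ hc u

/-- `π(f) a† u = π(z f) u` on the domain of `a†`. -/
theorem IsRaise.schwartzToeplitz_eq {f : 𝓢(ℂ, ℂ)} (hf : ∀ z, conj (f z) = f z)
    {u b : fockSpace θ hθ} (h : IsRaise u b) :
    schwartzToeplitz hθ f b = schwartzToeplitz hθ (mulZ f) u := by
  refine fockSpace_ext fun m => ?_
  rw [← inner_toeplitz_left f.toBoundedContinuousFunction _ (fun z => (hf z).symm),
    (isLower_schwartzToeplitz f _).inner_eq h]
  refine inner_toeplitz_left _ _ (fun z => ?_) _ _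
  change mulZ f z = conj (mulZbar f z)
  rw [mulZ_apply, mulZbar_apply, map_mul, hf, Complex.conj_conj]

/-- `π(f) a u = π(z̄ f) u - θ π(∂f) u` on the domain of `a`. -/
theorem IsLower.schwartzToeplitz_eq {f : 𝓢(ℂ, ℂ)} (hf : ∀ z, conj (f z) = f z)
    {u b : fockSpace θ hθ} (h : IsLower u b) :
    schwartzToeplitz hθ f b = schwartzToeplitz hθ (mulZbar f) u -
      (θ : ℂ) • schwartzToeplitz hθ (schwartzDz f) u := by
  refine fockSpace_ext fun m => ?_
  rw [← inner_toeplitz_left f.toBoundedContinuousFunction _ (fun z => (hf z).symm), ← conj_inner_fockSpace,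
    ← h.inner_eq (isRaise_schwartzToeplitz f _), conj_inner_fockSpace, inner_sub_left,
    inner_sub_right, inner_fockSpace_smul]
  have e1 := inner_toeplitz_left (mulZ f).toBoundedContinuousFunction
    (mulZbar f).toBoundedContinuousFunction (fun z => by
      change mulZbar f z = conj (mulZ f z)
      rw [mulZ_apply, mulZbar_apply, map_mul, hf]) (fockBasis θ hθ m) u
  have e2 := inner_toeplitz_left (schwartzDzbar f).toBoundedContinuousFunction
    (schwartzDz f).toBoundedContinuousFunction (fun z => by
      change schwartzDz f z = conj (schwartzDzbar f z)
      rw [schwartzDz_apply, schwartzDzbar_apply, conj_dzbar_of_real hf]) (fockBasis θ hθ m) u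
  have e3 : ∀ x y : fockSpace θ hθ, ⟪(θ : ℂ) • x, y⟫_ℂ = θ * ⟪x, y⟫_ℂ := fun x y => by
    have := inner_smul_left x y (θ : ℂ)
    rwa [Complex.conj_ofReal] at this
  rw [e1, e3, e2]

/-- A spinor whose first component is in the domain of both ladder operators and whose second
component is in the domain of `a†` belongs to the domain of `D_θ`. -/
theorem mem_truncDirac_domain {v : Double (fockSpace θ hθ)} {b b' c : fockSpace θ hθ}
    (h1 : IsLower v.fst b) (h2 : IsRaise v.fst b') (h3 : IsRaise v.snd c) :
    v ∈ (truncDirac θ hθ).domain := by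
  have e1 := (h3.smul (-2)).isWeakDzbar
  have e2 := (h1.smul 2).isWeakDz (h2.smul 2)
  exact Submodule.mem_map.2 ⟨(ampl (fockSpace θ hθ).subtypeL v, WithLp.toLp 2 (_, _)),
    ⟨e1, e2⟩, rfl⟩

/-- On its domain, `D_θ = (2 / θ) [[0, a†], [a, 0]]`. -/
theorem truncDirac_ladder (v : (truncDirac θ hθ).domain) :
    IsLower (v : Double (fockSpace θ hθ)).fst ((θ / 2 : ℂ) • (truncDirac θ hθ v).snd) ∧
      IsRaise (v : Double (fockSpace θ hθ)).snd ((θ / 2 : ℂ) • (truncDirac θ hθ v).fst) := by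
  have hg := Submodule.mem_graph_toLinearPMap diracGraph_functional
    ⟨ampl (fockSpace θ hθ).subtypeL v, v.2⟩
  obtain ⟨g1, g2⟩ := hg
  have l := (isLower_of_isWeakDz (u := (2 : ℂ) • (v : Double (fockSpace θ hθ)).fst) g2).smul
    (1 / 2)
  have r := (isRaise_of_isWeakDzbar (u := (-2 : ℂ) • (v : Double (fockSpace θ hθ)).snd) g1).smul
    (-1 / 2)
  constructor
  · convert l using 1
    · rw [smul_smul]
      norm_num
    · change (θ / 2 : ℂ) • ((2 : ℂ) • _) = _
      rw [smul_smul, smul_smul]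
      congr 1
      ring
  · convert r using 1
    · rw [smul_smul]
      norm_num
    · change (θ / 2 : ℂ) • ((2 : ℂ) • _) = _
      rw [smul_smul, smul_smul]
      congr 1
      ring

theorem ampl_mem_domain (f : 𝓢(ℂ, ℂ)) (v : Double (fockSpace θ hθ)) :
    ampl (schwartzToeplitz hθ f) v ∈ (truncDirac θ hθ).domain :=
  mem_truncDirac_domain (isLower_schwartzToeplitz f v.fst) (isRaise_schwartzToeplitz f v.fst)
    (isRaise_schwartzToeplitz f v.snd)

/-- The commutator of `D_θ` with `c + π(f)`, for real `f`, is `2 [[0, -π(∂̄f)], [π(∂f), 0]]`. -/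
theorem commutator_eq {f : 𝓢(ℂ, ℂ)} (hf : ∀ z, conj (f z) = f z) (c : ℝ)
    {T : fockSpace θ hθ →L[ℂ] fockSpace θ hθ} (hT : ∀ x, T x = (c : ℂ) • x + schwartzToeplitz hθ f x)
    (v : (truncDirac θ hθ).domain) (hv : ampl T (v : Double (fockSpace θ hθ)) ∈
      (truncDirac θ hθ).domain) :
    truncDirac θ hθ ⟨ampl T (v : Double (fockSpace θ hθ)), hv⟩ - ampl T (truncDirac θ hθ v) =
      WithLp.toLp 2
        (-((2 : ℂ) • schwartzToeplitz hθ (schwartzDzbar f) (v : Double (fockSpace θ hθ)).snd),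
          (2 : ℂ) • schwartzToeplitz hθ (schwartzDz f) (v : Double (fockSpace θ hθ)).fst) := by
  have hθ' : (θ : ℂ) ≠ 0 := by exact_mod_cast hθ.ne'
  obtain ⟨l, r⟩ := truncDirac_ladder v
  obtain ⟨l', r'⟩ := truncDirac_ladder ⟨ampl T (v : Double (fockSpace θ hθ)), hv⟩
  set Dv := truncDirac θ hθ v
  set DTv := truncDirac θ hθ ⟨ampl T (v : Double (fockSpace θ hθ)), hv⟩
  have l2 := (l.smul c).add (isLower_schwartzToeplitz f (v : Double (fockSpace θ hθ)).fst)
  have r2 := (r.smul c).add (isRaise_schwartzToeplitz f (v : Double (fockSpace θ hθ)).snd)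
  rw [← hT] at l2 r2
  have el := l'.unique l2
  have er := r'.unique r2
  have kl := l.schwartzToeplitz_eq hf
  have kr := r.schwartzToeplitz_eq hf
  rw [map_smul] at kl kr
  have hs : (2 / θ : ℂ) * (θ / 2) = 1 := by field_simp
  have hs2 : (2 / θ : ℂ) * θ = 2 := by field_simp
  have fin : ∀ {x y p q : fockSpace θ hθ},
      (θ / 2 : ℂ) • x = (c : ℂ) • ((θ / 2 : ℂ) • y) + p →
      (θ / 2 : ℂ) • schwartzToeplitz hθ f y = p - (θ : ℂ) • q → x - T y = (2 : ℂ) • q := by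
    intro x y p q h1 h2
    have h3 := congrArg (fun t => (2 / θ : ℂ) • t) h1
    have h4 := congrArg (fun t => (2 / θ : ℂ) • t) h2
    simp only [smul_add, smul_sub, smul_smul, hs, hs2, one_smul, mul_left_comm _ (c : ℂ),
      mul_one] at h3 h4
    rw [h3, hT, h4]
    abel
  have e1 : DTv.fst - T Dv.fst =
      -((2 : ℂ) • schwartzToeplitz hθ (schwartzDzbar f) (v : Double (fockSpace θ hθ)).snd) := by
    rw [← smul_neg]
    refine fin er ?_
    rw [kr, smul_neg]
    abel
  have e2 : DTv.snd - T Dv.snd =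
      (2 : ℂ) • schwartzToeplitz hθ (schwartzDz f) (v : Double (fockSpace θ hθ)).fst :=
    fin el kl
  exact WithLp.ofLp_injective 2 (Prod.ext e1 e2)

/-- A real Schwartz function whose gradient is bounded by one gives a commutator of norm at most
one. -/
theorem commutatorNorm_schwartzToeplitz_le {f : 𝓢(ℂ, ℂ)} (hf : ∀ z, conj (f z) = f z)
    (hb : ∀ z, ‖2 * dz f z‖ ≤ 1) :
    commutatorNorm (truncDirac θ hθ) (ampl (schwartzToeplitz hθ f)) ≤ 1 := by
  have hdz : ∀ u : fockSpace θ hθ, ‖(2 : ℂ) • schwartzToeplitz hθ (schwartzDz f) u‖ ≤ ‖u‖ := by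
    intro u
    have := norm_toeplitz_apply_le (schwartzDz f).toBoundedContinuousFunction (C := 1 / 2)
      (fun z => by
        have h := hb z
        rw [norm_mul, Complex.norm_ofNat, ← schwartzDz_apply] at h
        rw [SchwartzMap.toBoundedContinuousFunction_apply]
        linarith) u
    rw [norm_smul, Complex.norm_ofNat]
    linarith
  have hdzbar : ∀ u : fockSpace θ hθ,
      ‖(2 : ℂ) • schwartzToeplitz hθ (schwartzDzbar f) u‖ ≤ ‖u‖ := by
    intro u
    have := norm_toeplitz_apply_le (schwartzDzbar f).toBoundedContinuousFunction (C := 1 / 2)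
      (fun z => by
        have h := hb z
        rw [norm_mul, Complex.norm_ofNat, ← conj_dzbar_of_real hf, RCLike.norm_conj,
          ← schwartzDzbar_apply] at h
        rw [SchwartzMap.toBoundedContinuousFunction_apply]
        linarith) u
    rw [norm_smul, Complex.norm_ofNat]
    linarith
  refine iInf₂_le (1 : ℝ≥0) fun v => ⟨ampl_mem_domain f _, ?_⟩
  rw [commutator_eq hf 0 (fun x => by simp) v, NNReal.coe_one, one_mul]
  refine (pow_le_pow_iff_left₀ (norm_nonneg _) (norm_nonneg _) two_ne_zero).1 ?_
  rw [WithLp.prod_norm_sq_eq_of_L2, WithLp.prod_norm_sq_eq_of_L2, add_comm]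
  refine add_le_add (pow_le_pow_left₀ (norm_nonneg _) (hdz _) 2)
    (pow_le_pow_left₀ (norm_nonneg _) ?_ 2)
  change ‖-_‖ ≤ _
  rw [norm_neg]
  exact hdzbar _

theorem isLower_zero : IsLower (0 : fockSpace θ hθ) 0 := fun m => by simp

theorem isRaise_zero : IsRaise (0 : fockSpace θ hθ) 0 := fun m => by simp

theorem isRaise_fockBasis (n : ℕ) :
    IsRaise (fockBasis θ hθ n) ((ladder θ (n + 1) : ℂ) • fockBasis θ hθ (n + 1)) := by
  intro m
  rw [inner_fockSpace_smul, inner_fockBasis_fockBasis, inner_fockBasis_fockBasis]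
  cases m with
  | zero => simp
  | succ k =>
    by_cases h : k = n
    · subst h
      simp
    · rw [if_neg (by omega), if_neg (by omega), mul_zero, mul_zero]

theorem exists_isRaise_of_mem_span {u : fockSpace θ hθ}
    (hu : u ∈ Submodule.span ℂ (Set.range (fockBasis θ hθ))) :
    ∃ b, IsRaise u b := by
  induction hu using Submodule.span_induction with
  | mem x hx =>
    obtain ⟨n, rfl⟩ := hx
    exact ⟨_, isRaise_fockBasis n⟩
  | zero => exact ⟨0, isRaise_zero⟩
  | add x y _ _ hx hy =>
    obtain ⟨b, hb⟩ := hx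
    obtain ⟨c, hc⟩ := hy
    exact ⟨_, hb.add hc⟩
  | smul a x _ hx =>
    obtain ⟨b, hb⟩ := hx
    exact ⟨_, hb.smul a⟩

/-- If the commutator of `D_θ` with `c + π(f)` has norm at most one, then so has `π(2 ∂̄f)`. -/
theorem norm_toeplitz_dzbar_le {f : 𝓢(ℂ, ℂ)} (hf : ∀ z, conj (f z) = f z) (c : ℝ)
    {T : fockSpace θ hθ →L[ℂ] fockSpace θ hθ} (hT : ∀ x, T x = (c : ℂ) • x + schwartzToeplitz hθ f x)
    (h : commutatorNorm (truncDirac θ hθ) (ampl T) ≤ 1) (u : fockSpace θ hθ) :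
    ‖(2 : ℂ) • schwartzToeplitz hθ (schwartzDzbar f) u‖ ≤ ‖u‖ := by
  have hcl : IsClosed {u : fockSpace θ hθ |
      ‖(2 : ℂ) • schwartzToeplitz hθ (schwartzDzbar f) u‖ ≤ ‖u‖} :=
    isClosed_le (by fun_prop) (by fun_prop)
  refine hcl.closure_subset_iff.2 (fun x hx => ?_) (dense_span_fockBasis hθ u)
  obtain ⟨b, hb⟩ := exists_isRaise_of_mem_span hx
  set v : Double (fockSpace θ hθ) := WithLp.toLp 2 (0, x) with hv
  have hvd : v ∈ (truncDirac θ hθ).domain :=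
    mem_truncDirac_domain (v := v) isLower_zero isRaise_zero hb
  have hvn : ‖v‖ = ‖x‖ := by
    refine (pow_left_inj₀ (norm_nonneg _) (norm_nonneg _) two_ne_zero).1 ?_
    rw [WithLp.prod_norm_sq_eq_of_L2]
    simp [hv]
  refine Set.mem_ofPred.2 (le_of_forall_pos_le_add fun ε hε => ?_)
  have hδ : 0 < ε / (‖x‖ + 1) := by positivity
  have hlt : commutatorNorm (truncDirac θ hθ) (ampl T) < ((1 + (ε / (‖x‖ + 1)).toNNReal : ℝ≥0) :
      ℝ≥0∞) := by
    refine h.trans_lt ?_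
    rw [← ENNReal.coe_one, ENNReal.coe_lt_coe]
    exact lt_add_of_pos_right _ (Real.toNNReal_pos.2 hδ)
  obtain ⟨C, hC⟩ := iInf_lt_iff.1 hlt
  obtain ⟨hC1, hC2⟩ := iInf_lt_iff.1 hC
  have hC3 : (C : ℝ) ≤ 1 + ε / (‖x‖ + 1) := by
    have := NNReal.coe_le_coe.2 (ENNReal.coe_lt_coe.1 hC2).le
    rwa [NNReal.coe_add, NNReal.coe_one, Real.coe_toNNReal _ hδ.le] at this
  obtain ⟨hTv, hb⟩ := hC1 ⟨v, hvd⟩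
  rw [commutator_eq hf c hT ⟨v, hvd⟩ hTv] at hb
  have h1 := (WithLp.norm_fst_le _ _).trans hb
  have h2 : ‖(2 : ℂ) • schwartzToeplitz hθ (schwartzDzbar f) x‖ ≤ C * ‖x‖ := by
    rw [← hvn, ← norm_neg]
    exact h1
  refine h2.trans ((mul_le_mul_of_nonneg_right hC3 (norm_nonneg x)).trans ?_)
  have h3 : ε / (‖x‖ + 1) * ‖x‖ ≤ ε := by
    rw [div_mul_eq_mul_div, div_le_iff₀ (by positivity)]
    nlinarith [norm_nonneg x]
  linarith

end

/-! ### Coherent states as Gaussian averages -/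

section

variable {θ : ℝ} {hθ : 0 < θ}

/-- An `L²` convergent expansion in the functions `h_n` that converges pointwise represents its
pointwise sum. -/
theorem ae_eq_of_hasSum {c : ℕ → ℂ} {y : L2Plane} {g : ℂ → ℂ}
    (h : HasSum (fun n => c n • fockVec θ hθ n) y)
    (hg : ∀ w, HasSum (fun n => c n * fockFun θ n w) (g w)) :
    (y : ℂ → ℂ) =ᵐ[planeMeasure] g := by
  obtain ⟨ns, hns, hlim⟩ := (tendstoInMeasure_of_tendsto_Lp h.tendsto_sum_nat).exists_seq_tendsto_ae
  have hS : ∀ᵐ w ∂planeMeasure, ∀ N, (∑ n ∈ Finset.range N, c n • fockVec θ hθ n : L2Plane) w =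
      ∑ n ∈ Finset.range N, (c n • fockVec θ hθ n : L2Plane) w :=
    ae_all_iff.2 fun N => Lp.coeFn_fun_finsetSum _ _
  have hT : ∀ᵐ w ∂planeMeasure, ∀ n, (c n • fockVec θ hθ n : L2Plane) w = c n * fockFun θ n w := by
    refine ae_all_iff.2 fun n => ?_
    filter_upwards [Lp.coeFn_smul (c n) (fockVec θ hθ n), fockVec_ae hθ n] with w h1 h2
    rw [h1, Pi.smul_apply, h2, smul_eq_mul]
  filter_upwards [hlim, hS, hT] with w h1 h2 h3
  refine tendsto_nhds_unique h1 ?_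
  have h4 := (hg w).tendsto_sum_nat.comp hns.tendsto_atTop
  refine h4.congr fun i => ?_
  simp only [Function.comp_apply, h2, h3]

theorem hasSum_cohCoeff_mul_fockFun (hθ : 0 < θ) (z w : ℂ) :
    HasSum (fun n => cohCoeff θ z n * fockFun θ n w)
      ((Real.sqrt θ : ℂ)⁻¹ * Complex.exp (conj z * w / θ) *
        (Real.exp (-‖w‖ ^ 2 / (2 * θ)) : ℝ)) := by
  have h := NormedSpace.expSeries_div_hasSum_exp (𝔸 := ℂ) (conj z * w / θ)
  rw [← Complex.exp_eq_exp_ℂ] at h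
  refine ((h.mul_left (Real.sqrt θ : ℂ)⁻¹).mul_right
    ((Real.exp (-‖w‖ ^ 2 / (2 * θ)) : ℝ) : ℂ)).congr_fun fun n => ?_
  have hs : Real.sqrt (θ ^ n * (n.factorial : ℝ)) * Real.sqrt (θ ^ (n + 1) * (n.factorial : ℝ)) =
      θ ^ n * (n.factorial : ℝ) * Real.sqrt θ := by
    have e : θ ^ (n + 1) * (n.factorial : ℝ) = θ ^ n * (n.factorial : ℝ) * θ := by ring
    rw [e, Real.sqrt_mul (x := θ ^ n * (n.factorial : ℝ)) (by positivity), ← mul_assoc, Real.mul_self_sqrt (by positivity)]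
  have hs' : (Real.sqrt (θ ^ n * (n.factorial : ℝ)) : ℂ) *
      Real.sqrt (θ ^ (n + 1) * (n.factorial : ℝ)) =
      θ ^ n * (n.factorial : ℂ) * Real.sqrt θ := by exact_mod_cast hs
  rw [cohCoeff, fockFun, ← mul_assoc, div_mul_div_comm, hs', div_pow, mul_pow]
  congr 1
  rw [div_div, inv_mul_eq_div, div_div]

/-- The density `θ⁻¹ exp (-|w|² / θ)` of a centred Gaussian with respect to `d²z / π`. -/
def gaussDensity (θ : ℝ) (w : ℂ) : ℝ := θ⁻¹ * Real.exp (-‖w‖ ^ 2 / θ)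

theorem gaussDensity_nonneg (hθ : 0 < θ) (w : ℂ) : 0 ≤ gaussDensity θ w := by
  unfold gaussDensity
  positivity

theorem continuous_gaussDensity (θ : ℝ) : Continuous (gaussDensity θ) := by
  unfold gaussDensity
  fun_prop

theorem integral_gaussDensity (hθ : 0 < θ) : ∫ w, gaussDensity θ w ∂planeMeasure = 1 := by
  have h := integral_gaussian_moment hθ 0
  simp only [mul_zero, pow_zero, one_mul, zero_add, pow_one, Nat.factorial_zero, Nat.cast_one,
    mul_one] at h
  simp only [gaussDensity]
  rw [integral_const_mul, planeMeasure, integral_smul_measure, h,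
    ENNReal.toReal_ofReal (inv_nonneg.2 Real.pi_pos.le), smul_eq_mul]
  have := Real.pi_pos
  field_simp

theorem integrable_gaussDensity (hθ : 0 < θ) : Integrable (gaussDensity θ) planeMeasure :=
  Integrable.of_integral_ne_zero (by rw [integral_gaussDensity hθ]; exact one_ne_zero)

theorem cohVec_ae (hθ : 0 < θ) (z : ℂ) :
    ∀ᵐ w ∂planeMeasure, conj ((cohVec θ hθ z : L2Plane) w) * (cohVec θ hθ z : L2Plane) w =
      (gaussDensity θ (w - z) : ℂ) := by
  have h1 := ((summable_cohVec hθ z).hasSum).const_smul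
    ((Real.exp (-‖z‖ ^ 2 / (2 * θ)) : ℝ) : ℂ)
  have h2 := h1.mapL (fockSpace θ hθ).subtypeL
  have h3 : HasSum (fun n => (((Real.exp (-‖z‖ ^ 2 / (2 * θ)) : ℝ) : ℂ) * cohCoeff θ z n) •
      fockVec θ hθ n) (cohVec θ hθ z : L2Plane) := by
    refine h2.congr_fun fun n => ?_
    rw [mul_smul]
    rfl
  have h4 := ae_eq_of_hasSum h3 fun w =>
    ((hasSum_cohCoeff_mul_fockFun hθ z w).mul_left
      ((Real.exp (-‖z‖ ^ 2 / (2 * θ)) : ℝ) : ℂ)).congr_fun fun n => mul_assoc _ _ _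
  filter_upwards [h4] with w hw
  rw [hw, mul_comm, Complex.mul_conj, Complex.normSq_eq_norm_sq]
  congr 1
  rw [norm_mul, norm_mul, norm_mul, norm_inv, Complex.norm_real, Complex.norm_real,
    Complex.norm_real, Complex.norm_exp, Real.norm_eq_abs, Real.norm_eq_abs, Real.norm_eq_abs,
    abs_of_pos (Real.exp_pos _), abs_of_pos (Real.exp_pos _), abs_of_nonneg (Real.sqrt_nonneg _),
    mul_pow, mul_pow, mul_pow, inv_pow, Real.sq_sqrt hθ.le, ← Real.exp_nat_mul,
    ← Real.exp_nat_mul, ← Real.exp_nat_mul, gaussDensity]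
  rw [show ∀ a b c d : ℝ, a * (b * c * d) = b * (a * c * d) from fun a b c d => by ring,
    ← Real.exp_add, ← Real.exp_add]
  congr 2
  have e1 : ‖w - z‖ ^ 2 = ‖w‖ ^ 2 + ‖z‖ ^ 2 - 2 * (conj z * w).re := by
    rw [← Complex.normSq_eq_norm_sq, ← Complex.normSq_eq_norm_sq, ← Complex.normSq_eq_norm_sq,
      Complex.normSq_sub]
    congr 3
    rw [mul_comm]
  have e2 : (conj z * w / θ).re = (conj z * w).re / θ := Complex.div_ofReal_re _ _
  rw [e1, e2]
  field_simp
  push_cast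
  ring

/-- The coherent state at `z` averages the symbol against a Gaussian centred at `z`. -/
theorem inner_cohVec_toeplitz (hθ : 0 < θ) (f : ℂ →ᵇ ℂ) (z : ℂ) :
    ⟪cohVec θ hθ z, toeplitz θ hθ f (cohVec θ hθ z)⟫_ℂ =
      ∫ w, f (z + w) * (gaussDensity θ w : ℂ) ∂planeMeasure := by
  rw [inner_toeplitz]
  have h1 : ∫ w, conj ((cohVec θ hθ z : L2Plane) w) * (f w * (cohVec θ hθ z : L2Plane) w)
      ∂planeMeasure = ∫ w, f w * (gaussDensity θ (w - z) : ℂ) ∂planeMeasure := by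
    refine integral_congr_ae ?_
    filter_upwards [cohVec_ae hθ z] with w hw
    rw [← hw]
    ring
  rw [h1, ← integral_add_left_eq_self (fun w => f w * (gaussDensity θ (w - z) : ℂ)) z]
  simp

/-! ### The order unit space -/

theorem toeplitz_add_apply (f g k : ℂ →ᵇ ℂ) (hk : ∀ z, k z = f z + g z) (u : fockSpace θ hθ) :
    toeplitz θ hθ k u = toeplitz θ hθ f u + toeplitz θ hθ g u := by
  have h : mulOp k (u : L2Plane) = mulOp f (u : L2Plane) + mulOp g (u : L2Plane) := by
    refine Lp.ext ?_
    filter_upwards [mulOp_ae f u, mulOp_ae g u, mulOp_ae k u,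
      Lp.coeFn_add (mulOp f (u : L2Plane)) (mulOp g (u : L2Plane))] with z h1 h2 h3 h4
    rw [h4, Pi.add_apply, h1, h2, h3, hk, add_mul]
  exact (congrArg (fockProj θ hθ) h).trans (map_add _ _ _)

theorem toeplitz_smul_apply (c : ℂ) (f k : ℂ →ᵇ ℂ) (hk : ∀ z, k z = c * f z)
    (u : fockSpace θ hθ) : toeplitz θ hθ k u = c • toeplitz θ hθ f u := by
  have h : mulOp k (u : L2Plane) = c • mulOp f (u : L2Plane) := by
    refine Lp.ext ?_
    filter_upwards [mulOp_ae f u, mulOp_ae k u,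
      Lp.coeFn_smul c (mulOp f (u : L2Plane))] with z h1 h2 h3
    rw [h3, Pi.smul_apply, h1, h2, hk, smul_eq_mul, mul_assoc]
  exact (congrArg (fockProj θ hθ) h).trans (map_smul _ _ _)

/-- The elements of `O_θ` are the operators `c + π_θ(f)`. -/
theorem exists_of_mem_orderUnitSpace {T : fockSpace θ hθ →L[ℂ] fockSpace θ hθ}
    (hT : T ∈ orderUnitSpace θ hθ) :
    ∃ (c : ℝ) (f : 𝓢(ℂ, ℂ)), (∀ z, conj (f z) = f z) ∧
      ∀ x, T x = (c : ℂ) • x + schwartzToeplitz hθ f x := by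
  refine Submodule.span_induction (p := fun T _ => ∃ (c : ℝ) (f : 𝓢(ℂ, ℂ)),
    (∀ z, conj (f z) = f z) ∧ ∀ x, T x = (c : ℂ) • x + schwartzToeplitz hθ f x)
    ?_ ?_ ?_ ?_ hT
  · rintro S (rfl | ⟨f, hf, rfl⟩)
    · refine ⟨1, 0, fun z => by simp, fun x => ?_⟩
      have h0 := toeplitz_smul_apply 0 (0 : 𝓢(ℂ, ℂ)).toBoundedContinuousFunction
        (0 : 𝓢(ℂ, ℂ)).toBoundedContinuousFunction (fun z => by simp) x
      rw [h0]
      simp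
    · exact ⟨0, f, hf, fun x => by simp⟩
  · refine ⟨0, 0, fun z => by simp, fun x => ?_⟩
    have h0 := toeplitz_smul_apply 0 (0 : 𝓢(ℂ, ℂ)).toBoundedContinuousFunction
      (0 : 𝓢(ℂ, ℂ)).toBoundedContinuousFunction (fun z => by simp) x
    rw [h0]
    simp
  · rintro S S' _ _ ⟨c, f, hf, h⟩ ⟨c', f', hf', h'⟩
    refine ⟨c + c', f + f', fun z => by simp [hf, hf'], fun x => ?_⟩
    have h0 := toeplitz_add_apply f.toBoundedContinuousFunction f'.toBoundedContinuousFunction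
      (f + f').toBoundedContinuousFunction (fun z => rfl) x
    rw [h0, add_apply, h, h', Complex.ofReal_add, add_smul]
    abel
  · rintro a S _ ⟨c, f, hf, h⟩
    refine ⟨a * c, a • f, fun z => by simp [hf], fun x => ?_⟩
    have h0 := toeplitz_smul_apply (a : ℂ) f.toBoundedContinuousFunction
      (a • f).toBoundedContinuousFunction (fun z => by simp) x
    have h1 : (a • S) x = (a : ℂ) • S x := rfl
    refine h1.trans ?_
    rw [h0, h, Complex.ofReal_mul, smul_add, smul_smul]

theorem coherentState_apply (T : orderUnitSpace θ hθ) (z : ℂ) :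
    (coherentState θ hθ z).toFunctional T =
      (⟪cohVec θ hθ z, (T : fockSpace θ hθ →L[ℂ] fockSpace θ hθ) (cohVec θ hθ z)⟫_ℂ).re := rfl

/-! ### The distance is at most `|z - z'|` -/

/-- The Gaussian average of `f` around `z`. -/
def gaussAvg (θ : ℝ) (f : 𝓢(ℂ, ℂ)) (z : ℂ) : ℂ :=
  ∫ w, f (z + w) * (gaussDensity θ w : ℂ) ∂planeMeasure

theorem inner_cohVec_schwartzToeplitz (hθ : 0 < θ) (f : 𝓢(ℂ, ℂ)) (z : ℂ) :
    ⟪cohVec θ hθ z, schwartzToeplitz hθ f (cohVec θ hθ z)⟫_ℂ = gaussAvg θ f z :=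
  inner_cohVec_toeplitz hθ _ z

theorem integrable_mul_gaussDensity (hθ : 0 < θ) (f : 𝓢(ℂ, ℂ)) (z : ℂ) :
    Integrable (fun w => f (z + w) * (gaussDensity θ w : ℂ)) planeMeasure :=
  (integrable_gaussDensity hθ).ofReal.bdd_mul
    (c := ‖f.toBoundedContinuousFunction‖)
    (f.continuous.comp (continuous_const.add continuous_id)).aestronglyMeasurable
    (ae_of_all _ fun w => f.toBoundedContinuousFunction.norm_coe_le_norm (z + w))

theorem hasDerivAt_gaussAvg (hθ : 0 < θ) (f : 𝓢(ℂ, ℂ)) (z v : ℂ) (t : ℝ) :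
    HasDerivAt (fun s : ℝ => gaussAvg θ f (z + s * v))
      (v * gaussAvg θ (schwartzDz f) (z + t * v) +
        conj v * gaussAvg θ (schwartzDzbar f) (z + t * v)) t := by
  set F' : ℝ → ℂ → ℂ := fun s w =>
    fderiv ℝ f (z + s * v + w) v * (gaussDensity θ w : ℂ) with hF'
  obtain ⟨C, hC⟩ : ∃ C, ∀ x, ‖fderiv ℝ f x‖ ≤ C :=
    ⟨_, (SchwartzMap.fderivCLM ℝ ℂ ℂ f).toBoundedContinuousFunction.norm_coe_le_norm⟩
  have hc : Continuous (fderiv ℝ f) := (SchwartzMap.fderivCLM ℝ ℂ ℂ f).continuous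
  have hg : Continuous fun w => (gaussDensity θ w : ℂ) :=
    Complex.continuous_ofReal.comp (continuous_gaussDensity θ)
  have hline : ∀ (w : ℂ) (s : ℝ), HasDerivAt (fun s : ℝ => z + s * v + w) v s := fun w s => by
    simpa using (((Complex.ofRealCLM.hasDerivAt (x := s)).mul_const v).const_add z).add_const w
  have key := (hasDerivAt_integral_of_dominated_loc_of_deriv_le (μ := planeMeasure)
    (F := fun (s : ℝ) w => f (z + s * v + w) * (gaussDensity θ w : ℂ)) (F' := F') (x₀ := t)
    (s := Set.univ) (bound := fun w => C * ‖v‖ * gaussDensity θ w) univ_mem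
    (Eventually.of_forall fun s =>
      (integrable_mul_gaussDensity hθ f (z + s * v)).aestronglyMeasurable)
    (integrable_mul_gaussDensity hθ f (z + t * v)) ?_ ?_
    ((integrable_gaussDensity hθ).const_mul _) ?_).2
  · have e : ∫ w, F' t w ∂planeMeasure = v * gaussAvg θ (schwartzDz f) (z + t * v) +
        conj v * gaussAvg θ (schwartzDzbar f) (z + t * v) := by
      rw [gaussAvg, gaussAvg, ← integral_const_mul, ← integral_const_mul, ← integral_add
        ((integrable_mul_gaussDensity hθ _ _).const_mul _)
        ((integrable_mul_gaussDensity hθ _ _).const_mul _)]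
      refine integral_congr_ae (ae_of_all _ fun w => ?_)
      simp only [hF', fderiv_eq_wirtMap, wirtMap_apply, schwartzDz_apply, schwartzDzbar_apply]
      ring
    rwa [e] at key
  · exact (((hc.comp (continuous_const.add continuous_id)).clm_apply continuous_const).mul
      hg).aestronglyMeasurable
  · refine ae_of_all _ fun w s _ => ?_
    rw [hF', norm_mul, Complex.norm_real, Real.norm_eq_abs,
      abs_of_nonneg (gaussDensity_nonneg hθ w)]
    refine mul_le_mul_of_nonneg_right ?_ (gaussDensity_nonneg hθ w)
    exact ((fderiv ℝ f _).le_opNorm v).trans (mul_le_mul_of_nonneg_right (hC _) (norm_nonneg v))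
  · refine ae_of_all _ fun w s _ => ?_
    exact ((f.hasFDerivAt _).comp_hasDerivAt s (hline w s)).mul_const _

/-- If the commutator of `D_θ` with `T` has norm at most one, then `Ψ_z(T)` is a `1`-Lipschitz
function of `z`: its gradient is `Ψ_z(π(2 ∂̄f))` when `T = c + π(f)`. -/
theorem coherentState_sub_le (T : orderUnitSpace θ hθ)
    (h : commutatorNorm (truncDirac θ hθ)
      (ampl (T : fockSpace θ hθ →L[ℂ] fockSpace θ hθ)) ≤ 1) (z z' : ℂ) :
    (coherentState θ hθ z).toFunctional T - (coherentState θ hθ z').toFunctional T ≤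
      ‖z - z'‖ := by
  obtain ⟨c, f, hf, hT⟩ := exists_of_mem_orderUnitSpace T.2
  have hn := norm_toeplitz_dzbar_le hf c hT h
  have hbar : ∀ w, ‖gaussAvg θ (schwartzDzbar f) w‖ ≤ 1 / 2 := by
    intro w
    have h1 := hn (cohVec θ hθ w)
    have h2 := norm_inner_le_norm (𝕜 := ℂ) (cohVec θ hθ w)
      (schwartzToeplitz hθ (schwartzDzbar f) (cohVec θ hθ w))
    rw [inner_cohVec_schwartzToeplitz, norm_cohVec, one_mul] at h2
    rw [norm_smul, Complex.norm_ofNat, norm_cohVec] at h1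
    linarith
  have hdz : ∀ w, ‖gaussAvg θ (schwartzDz f) w‖ ≤ 1 / 2 := by
    intro w
    have e : gaussAvg θ (schwartzDz f) w = conj (gaussAvg θ (schwartzDzbar f) w) := by
      rw [gaussAvg, gaussAvg, ← integral_conj]
      refine integral_congr_ae (ae_of_all _ fun x => ?_)
      simp only [map_mul, Complex.conj_ofReal, schwartzDz_apply, schwartzDzbar_apply,
        conj_dzbar_of_real hf]
    rw [e, RCLike.norm_conj]
    exact hbar w
  have hmv : ‖gaussAvg θ f (z' + (1 : ℝ) * (z - z')) - gaussAvg θ f (z' + (0 : ℝ) * (z - z'))‖ ≤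
      ‖z - z'‖ := by
    refine norm_image_sub_le_of_norm_deriv_le_segment_01'
      (f := fun s : ℝ => gaussAvg θ f (z' + s * (z - z')))
      (fun t _ => (hasDerivAt_gaussAvg hθ f z' (z - z') t).hasDerivWithinAt) fun t _ => ?_
    refine (norm_add_le _ _).trans ?_
    rw [norm_mul, norm_mul, RCLike.norm_conj]
    nlinarith [hbar (z' + t * (z - z')), hdz (z' + t * (z - z')), norm_nonneg (z - z'),
      mul_le_mul_of_nonneg_left (hbar (z' + t * (z - z'))) (norm_nonneg (z - z')),
      mul_le_mul_of_nonneg_left (hdz (z' + t * (z - z'))) (norm_nonneg (z - z'))]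
  have hval : ∀ w, (coherentState θ hθ w).toFunctional T = c + (gaussAvg θ f w).re := by
    intro w
    have h1 : ⟪cohVec θ hθ w, cohVec θ hθ w⟫_ℂ = 1 := by
      have := inner_self_eq_norm_sq_to_K (𝕜 := ℂ) (cohVec θ hθ w)
      rw [norm_cohVec] at this
      simpa using this
    rw [coherentState_apply, hT, inner_add_right, inner_fockSpace_smul, h1,
      inner_cohVec_schwartzToeplitz]
    simp
  rw [hval, hval]
  simp only [Complex.ofReal_one, one_mul, Complex.ofReal_zero, zero_mul, add_zero,
    add_sub_cancel] at hmv
  have := (Complex.re_le_norm _).trans hmv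
  rw [Complex.sub_re] at this
  linarith

end

/-! ### The distance is at least `|z - z'|` -/

section

variable {θ : ℝ} {hθ : 0 < θ}

/-- A real valued test function with gradient bounded by one bounds the distance from below by the
difference of its Gaussian averages. -/
theorem le_spectralDist (hθ : 0 < θ) {F : ℂ → ℝ} (hF : ContDiff ℝ ∞ F) (hFc : HasCompactSupport F)
    (hb : ∀ x, ‖fderiv ℝ F x‖ ≤ 1) (z z' : ℂ) :
    ((∫ w, (F (z + w) - F (z' + w)) * gaussDensity θ w ∂planeMeasure : ℝ) : EReal) ≤
      spectralDist (truncDirac θ hθ) (coherentState θ hθ z) (coherentState θ hθ z') := by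
  have hs : ContDiff ℝ ∞ (fun x => (F x : ℂ)) := Complex.ofRealCLM.contDiff.comp hF
  have hc : HasCompactSupport (fun x => (F x : ℂ)) :=
    hFc.comp_left (g := ((↑) : ℝ → ℂ)) (by simp)
  set f : 𝓢(ℂ, ℂ) := hc.toSchwartzMap hs with hf
  have hfF : ∀ x, f x = (F x : ℂ) := fun x => rfl
  have hfr : ∀ x, conj (f x) = f x := fun x => by rw [hfF, Complex.conj_ofReal]
  have hfd : ∀ x v, fderiv ℝ f x v = (fderiv ℝ F x v : ℂ) := by
    intro x v
    have h := Complex.ofRealCLM.hasFDerivAt.comp x (hF.differentiable (by simp) x).hasFDerivAt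
    have e : fderiv ℝ f x = Complex.ofRealCLM ∘L fderiv ℝ F x := HasFDerivAt.fderiv h
    rw [e]
    rfl
  have hgrad : ∀ x, ‖2 * dz f x‖ ≤ 1 := by
    intro x
    set a := fderiv ℝ F x 1
    set b := fderiv ℝ F x Complex.I
    have e : 2 * dz f x = conj ((a : ℂ) + b * Complex.I) := by
      rw [dz, hfd, hfd, map_add, map_mul, Complex.conj_ofReal, Complex.conj_ofReal, Complex.conj_I]
      ring
    -- the derivative in the direction of the gradient is the square of its length
    have h1 : fderiv ℝ F x ((a : ℂ) + b * Complex.I) = ‖(a : ℂ) + b * Complex.I‖ ^ 2 := by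
      have e1 : (a : ℂ) + b * Complex.I = a • (1 : ℂ) + b • Complex.I := by
        simp
      rw [← Complex.normSq_eq_norm_sq, Complex.normSq_add_mul_I, e1, map_add, map_smul, map_smul]
      simp only [smul_eq_mul, a, b]
      ring
    have h2 := (fderiv ℝ F x).le_opNorm ((a : ℂ) + b * Complex.I)
    rw [h1, norm_pow, norm_norm] at h2
    rw [e, RCLike.norm_conj]
    by_contra! hlt
    nlinarith [hb x, norm_nonneg ((a : ℂ) + b * Complex.I)]
  have hmem : schwartzToeplitz hθ f ∈ orderUnitSpace θ hθ :=
    Submodule.subset_span (Or.inr ⟨f, hfr, rfl⟩)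
  have hle := le_iSup₂ (f := fun (T : orderUnitSpace θ hθ)
    (_ : commutatorNorm (truncDirac θ hθ)
      (ampl (T : fockSpace θ hθ →L[ℂ] fockSpace θ hθ)) ≤ 1) =>
      (((coherentState θ hθ z).toFunctional T - (coherentState θ hθ z').toFunctional T : ℝ) :
        EReal)) ⟨schwartzToeplitz hθ f, hmem⟩ (commutatorNorm_schwartzToeplitz_le hfr hgrad)
  refine le_trans (le_of_eq ?_) hle
  congr 1
  have hval : ∀ x, (coherentState θ hθ x).toFunctional ⟨schwartzToeplitz hθ f, hmem⟩ =
      ∫ w, F (x + w) * gaussDensity θ w ∂planeMeasure := by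
    intro x
    rw [coherentState_apply, inner_cohVec_schwartzToeplitz, gaussAvg]
    simp_rw [hfF, ← Complex.ofReal_mul]
    rw [integral_complex_ofReal, Complex.ofReal_re]
  have hint : ∀ x, Integrable (fun w => F (x + w) * gaussDensity θ w) planeMeasure := by
    intro x
    refine (integrable_mul_gaussDensity hθ f x).re.congr (ae_of_all _ fun w => ?_)
    simp [hfF, ← Complex.ofReal_mul]
  rw [hval, hval, ← integral_sub (hint z) (hint z')]
  simp_rw [sub_mul]

/-- A smooth bump function on the line, equal to one near zero. -/
def lineBump : ContDiffBump (0 : ℝ) := ⟨1, 2, one_pos, one_lt_two⟩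

/-- The linear function `w ↦ ⟨u, w⟩`, cut off in the variable `log (1 + |w|²)` at scale `1 / ε`. As
the cutoff varies slowly on the logarithmic scale, the gradient remains bounded by `|u| + O(ε)`. -/
def cutLinear (u : ℂ) (ε : ℝ) (w : ℂ) : ℝ :=
  inner ℝ u w * lineBump (ε * Real.log (1 + ‖w‖ ^ 2))

theorem contDiff_cutLinear (u : ℂ) (ε : ℝ) : ContDiff ℝ ∞ (cutLinear u ε) := by
  have h1 : ContDiff ℝ ∞ fun w : ℂ => Real.log (1 + ‖w‖ ^ 2) :=
    (contDiff_const.add (contDiff_norm_sq ℝ)).log fun w => by positivity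
  exact (contDiff_const.inner ℝ contDiff_id).mul
    (lineBump.contDiff.comp (contDiff_const.mul h1))

theorem hasCompactSupport_cutLinear (u : ℂ) {ε : ℝ} (hε : 0 < ε) :
    HasCompactSupport (cutLinear u ε) := by
  refine HasCompactSupport.intro (isCompact_closedBall (0 : ℂ) (Real.exp (2 / ε))) fun w hw => ?_
  have hw' : Real.exp (2 / ε) < ‖w‖ := by simpa using hw
  have h1 : (1 : ℝ) < ‖w‖ := (Real.one_lt_exp_iff.2 (by positivity)).trans hw'
  have h2 : 2 / ε ≤ Real.log (1 + ‖w‖ ^ 2) := by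
    rw [Real.le_log_iff_exp_le (by positivity)]
    nlinarith
  have h3 : 2 ≤ ε * Real.log (1 + ‖w‖ ^ 2) := by
    rwa [div_le_iff₀' hε] at h2
  have h4 : lineBump (ε * Real.log (1 + ‖w‖ ^ 2)) = 0 :=
    lineBump.zero_of_le_dist (by
      rw [Real.dist_eq, sub_zero, abs_of_nonneg (by linarith)]
      exact h3)
  rw [cutLinear, h4, mul_zero]

theorem exists_deriv_lineBump_le : ∃ C, ∀ t, ‖deriv lineBump t‖ ≤ C :=
  ((lineBump.contDiff (n := 1)).continuous_deriv le_rfl).bounded_above_of_compact_support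
    lineBump.hasCompactSupport.deriv

theorem norm_fderiv_cutLinear_le {C : ℝ} (hC : ∀ t, ‖deriv lineBump t‖ ≤ C) {u : ℂ}
    (hu : ‖u‖ ≤ 1) {ε : ℝ} (hε : 0 < ε) (w : ℂ) :
    ‖fderiv ℝ (cutLinear u ε) w‖ ≤ 1 + 2 * C * ε := by
  have hC0 : 0 ≤ C := (norm_nonneg _).trans (hC 0)
  have hpos : (0 : ℝ) < 1 + ‖w‖ ^ 2 := by positivity
  have h1 : HasFDerivAt (fun w : ℂ => inner ℝ u w) (innerSL ℝ u) w := (innerSL ℝ u).hasFDerivAt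
  have h2 : HasFDerivAt (fun w : ℂ => ε * Real.log (1 + ‖w‖ ^ 2))
      (ε • ((1 + ‖w‖ ^ 2)⁻¹ • (2 • innerSL ℝ w))) w :=
    (((hasStrictFDerivAt_norm_sq w).hasFDerivAt.const_add 1).log hpos.ne').const_mul ε
  have h3 := (((lineBump.contDiff (n := 1)).differentiable (by simp)
    (ε * Real.log (1 + ‖w‖ ^ 2))).hasDerivAt).comp_hasFDerivAt w h2
  have h4 : HasFDerivAt (cutLinear u ε) _ w := h1.mul h3
  rw [h4.fderiv]
  set t := ε * Real.log (1 + ‖w‖ ^ 2)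
  have b1 : ‖lineBump t • innerSL ℝ u‖ ≤ 1 := by
    rw [norm_smul, innerSL_apply_norm, Real.norm_eq_abs, abs_of_nonneg lineBump.nonneg]
    exact mul_le_one₀ lineBump.le_one (norm_nonneg _) hu
  have b2 : ‖(inner ℝ u w : ℝ) • deriv lineBump t • ε • (1 + ‖w‖ ^ 2)⁻¹ • 2 • innerSL ℝ w‖ ≤
      2 * C * ε := by
    have e : ‖(2 : ℕ) • innerSL ℝ w‖ = 2 * ‖w‖ := by
      rw [← Nat.cast_smul_eq_nsmul ℝ, norm_smul, innerSL_apply_norm]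
      simp
    rw [norm_smul, norm_smul, norm_smul, norm_smul, e, Real.norm_of_nonneg hε.le,
      Real.norm_of_nonneg (inv_nonneg.2 hpos.le)]
    have i1 : ‖(inner ℝ u w : ℝ)‖ ≤ ‖w‖ :=
      (norm_inner_le_norm u w).trans (mul_le_of_le_one_left (norm_nonneg w) hu)
    have i2 : ‖w‖ * ((1 + ‖w‖ ^ 2)⁻¹ * (2 * ‖w‖)) ≤ 2 := by
      rw [mul_left_comm, inv_mul_le_iff₀ hpos]
      nlinarith
    calc ‖(inner ℝ u w : ℝ)‖ * (‖deriv lineBump t‖ * (ε * ((1 + ‖w‖ ^ 2)⁻¹ * (2 * ‖w‖))))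
        ≤ ‖w‖ * (C * (ε * ((1 + ‖w‖ ^ 2)⁻¹ * (2 * ‖w‖)))) := by
          gcongr
          exact hC t
      _ = (C * ε) * (‖w‖ * ((1 + ‖w‖ ^ 2)⁻¹ * (2 * ‖w‖))) := by ring
      _ ≤ (C * ε) * 2 := by gcongr
      _ = 2 * C * ε := by ring
  exact (norm_add_le _ _).trans ((add_le_add b2 b1).trans_eq (add_comm _ _))

theorem tendsto_cutLinear (u w : ℂ) {ε : ℕ → ℝ} (hε : Tendsto ε atTop (𝓝 0)) :
    Tendsto (fun k => cutLinear u (ε k) w) atTop (𝓝 (inner ℝ u w)) := by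
  have h1 : Tendsto (fun k => lineBump (ε k * Real.log (1 + ‖w‖ ^ 2))) atTop (𝓝 1) := by
    have h0 : lineBump 0 = 1 := lineBump.one_of_mem_closedBall (by simp [lineBump])
    have := (lineBump.continuous.tendsto (0 * Real.log (1 + ‖w‖ ^ 2))).comp
      (hε.mul_const (Real.log (1 + ‖w‖ ^ 2)))
    rwa [zero_mul, h0] at this
  simpa [cutLinear] using h1.const_mul (inner ℝ u w : ℝ)

theorem inner_sub_le_spectralDist (hθ : 0 < θ) {u : ℂ} (hu : ‖u‖ ≤ 1) (z z' : ℂ) :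
    ((inner ℝ u (z - z') : ℝ) : EReal) ≤
      spectralDist (truncDirac θ hθ) (coherentState θ hθ z) (coherentState θ hθ z') := by
  obtain ⟨C, hC⟩ := exists_deriv_lineBump_le
  have hC0 : 0 ≤ C := (norm_nonneg _).trans (hC 0)
  set ε : ℕ → ℝ := fun k => ((k : ℝ) + 1)⁻¹ with hε
  have hε0 : ∀ k, 0 < ε k := fun k => by positivity
  have hεt : Tendsto ε atTop (𝓝 0) := tendsto_inv_atTop_zero.comp
    (tendsto_atTop_add_const_right _ _ tendsto_natCast_atTop_atTop)
  have hr : ∀ k, 0 < 1 + 2 * C * ε k := fun k => by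
    have := hε0 k
    positivity
  -- dividing by the bound on the gradient gives admissible functions
  set F : ℕ → ℂ → ℝ := fun k w => (1 + 2 * C * ε k)⁻¹ * cutLinear u (ε k) w with hF
  have hFs : ∀ k, ContDiff ℝ ∞ (F k) := fun k => contDiff_const.mul (contDiff_cutLinear u _)
  have hFc : ∀ k, HasCompactSupport (F k) := fun k =>
    (hasCompactSupport_cutLinear u (hε0 k)).mul_left
  have hFb : ∀ k x, ‖fderiv ℝ (F k) x‖ ≤ 1 := by
    intro k x
    have e : fderiv ℝ (F k) x = (1 + 2 * C * ε k)⁻¹ • fderiv ℝ (cutLinear u (ε k)) x :=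
      fderiv_const_mul ((contDiff_cutLinear u (ε k)).differentiable (by simp) x) _
    rw [e, norm_smul, Real.norm_of_nonneg (inv_nonneg.2 (hr k).le), inv_mul_le_iff₀ (hr k),
      mul_one]
    exact norm_fderiv_cutLinear_le hC hu (hε0 k) x
  have hFt : ∀ w, Tendsto (fun k => F k w) atTop (𝓝 (inner ℝ u w)) := by
    intro w
    have h1 : Tendsto (fun k => (1 + 2 * C * ε k)⁻¹) atTop (𝓝 1) := by
      have := ((hεt.const_mul (2 * C)).const_add 1).inv₀ (by simp)
      simpa using this
    simpa using h1.mul (tendsto_cutLinear u w hεt)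
  have hlim : Tendsto (fun k => ∫ w, (F k (z + w) - F k (z' + w)) * gaussDensity θ w ∂planeMeasure)
      atTop (𝓝 (inner ℝ u (z - z'))) := by
    have e : (inner ℝ u (z - z') : ℝ) =
        ∫ w, inner ℝ u (z - z') * gaussDensity θ w ∂planeMeasure := by
      rw [integral_const_mul, integral_gaussDensity hθ, mul_one]
    rw [e]
    refine tendsto_integral_of_dominated_convergence (fun w => ‖z - z'‖ * gaussDensity θ w)
      (fun k => ?_) ((integrable_gaussDensity hθ).const_mul _)
      (fun k => ae_of_all _ fun w => ?_) (ae_of_all _ fun w => ?_)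
    · exact ((((hFs k).continuous.comp (continuous_const.add continuous_id)).sub
        ((hFs k).continuous.comp (continuous_const.add continuous_id))).mul
        (continuous_gaussDensity θ)).aestronglyMeasurable
    · rw [norm_mul, Real.norm_of_nonneg (gaussDensity_nonneg hθ w)]
      refine mul_le_mul_of_nonneg_right ?_ (gaussDensity_nonneg hθ w)
      have := convex_univ.norm_image_sub_le_of_norm_fderiv_le (𝕜 := ℝ) (f := F k) (C := 1)
        (x := z' + w) (y := z + w)
        (fun x _ => (hFs k).differentiable (by simp) x) (fun x _ => hFb k x) trivial trivial
      simpa using this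
    · have := ((hFt (z + w)).sub (hFt (z' + w))).mul_const (gaussDensity θ w)
      rwa [← inner_sub_right, add_sub_add_right_eq_sub] at this
  exact le_of_tendsto ((continuous_coe_real_ereal.tendsto _).comp hlim)
    (Eventually.of_forall fun k => le_spectralDist hθ (hFs k) (hFc k) (hFb k) z z')

end

end

end MoyalPlane

theorem mainTheorem11 (θ : ℝ) (hθ : 0 < θ) (z z' : ℂ) :
    MoyalPlane.spectralDist (MoyalPlane.truncDirac θ hθ)
      (MoyalPlane.coherentState θ hθ z) (MoyalPlane.coherentState θ hθ z') =
        ((‖z - z'‖ : ℝ) : EReal) := by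
  refine le_antisymm (iSup₂_le fun T hT => ?_) ?_
  · exact EReal.coe_le_coe_iff.2 (MoyalPlane.coherentState_sub_le T hT z z')
  · -- test with the linear function in the direction of `z - z'`; for `z = z'` this `u` is zero
    set u : ℂ := ‖z - z'‖⁻¹ • (z - z') with hu
    have hu1 : ‖u‖ ≤ 1 := by
      rw [hu, norm_smul, norm_inv, norm_norm]
      exact inv_mul_le_one
    have hu2 : inner ℝ u (z - z') = ‖z - z'‖ := by
      rw [hu, real_inner_smul_left, real_inner_self_eq_norm_sq]
      rcases eq_or_ne ‖z - z'‖ 0 with h | h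
      · simp [h]
      · field_simp
    have := MoyalPlane.inner_sub_le_spectralDist hθ hu1 z z'
    rwa [hu2] at this
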